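/- Let $p$ be a prime and let $G$ be a torsion-free pro-$p$ group which is polycyclic of Hirsch length $3$; that is, there is a finite series $1=G_0\le G_1\le\dots\le G_n=G$ of closed normal subgroups of $G$ such that every factor $G_i/G_{i-1}$ is (topologically) cyclic and exactly three of these factors are isomorphic to $\mathbb{Z}_p$. Then at least one of the following holds. (i) $G$ is virtually abelian (it has an open abelian subgroup), and it has one of the following types: - $G\cong\mathbb{Z}_p\times\mathbb{Z}_p\times\mathbb{Z}_p$; - $p=3$ and $G$ is a (torsion-free) extension of $\mathbb{Z}_3\times\mathbb{Z}_3\times\mathbb{Z}_3$ by $C_3$; - $p=2$ and $G$ is a (torsion-free) extension of $\mathbb{Z}_2\times\mathbb{Z}_2\times\mathbb{Z}_2$ by one of the finite groups $C_2$, $C_4$, $C_8$, $D_2$, $D_4$, $D_8$, $Q_{16}$. Here $C_n$ is the cyclic group of order $n$, $D_n$ is the dihedral group of order $2n$, $Q_{16}$ is the generalized quaternion group of order $16$, and an extension of $N$ by $Q$ has a normal subgroup isomorphic to $N$ with quotient isomorphic to $Q$. (ii) If $p>2$, then $G\cong(\mathbb{Z}_p\times\mathbb{Z}_p)\rtimes\mathbb{Z}_p$;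 if $p=2$, then $G$ has a closed subgroup of index $2$ isomorphic to $(\mathbb{Z}_2\times\mathbb{Z}_2)\rtimes\mathbb{Z}_2$. All isomorphisms with groups built from $\mathbb{Z}_p$ are isomorphisms of topological groups, and the semidirect products are semidirect products of topological groups. -/

import Mathlib

/-- A profinite group is pro-`p` if all its quotients by open normal subgroups are
(finite) `p`-groups. -/
structure IsProP (p : ℕ) (G : Type*) [Group G] [TopologicalSpace G] : Prop where
  isTopologicalGroup : IsTopologicalGroup G
  compactSpace : CompactSpace G
  t2Space : T2Space G
  totallyDisconnectedSpace : TotallyDisconnectedSpace G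
  isPGroup_quotient : ∀ U : Subgroup G, [U.Normal] → IsOpen (U : Set G) → IsPGroup p (G ⧸ U)

/-- No nontrivial element has finite order. (Mathlib's `IsMulTorsionFree` asks for unique roots,
which is stronger for noncommutative groups.) -/
def HasNoTorsion (G : Type*) [Group G] : Prop :=
  ∀ g : G, IsOfFinOrder g → g = 1

/-- A topological group is cyclic, in the topological sense, if some element generates a dense
subgroup. -/
def IsTopCyclic (Q : Type*) [Group Q] [TopologicalSpace Q] : Prop :=
  ∃ g : Q, Dense (Subgroup.zpowers g : Set Q)

/-- A finite series `1 = G₀ ≤ G₁ ≤ ⋯ ≤ Gₙ = G` of closed normal subgroups of `G` whose successive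
factors are (topologically) cyclic. -/
structure PolycyclicSeries (G : Type*) [Group G] [TopologicalSpace G] where
  length : ℕ
  term : Fin (length + 1) → Subgroup G
  isClosed : ∀ i, IsClosed (term i : Set G)
  [normal : ∀ i, (term i).Normal]
  term_zero : term 0 = ⊥
  term_last : term (Fin.last length) = ⊤
  le_succ : ∀ i : Fin length, term i.castSucc ≤ term i.succ
  cyclic_factor : ∀ i : Fin length,
    IsTopCyclic (term i.succ ⧸ (term i.castSucc).subgroupOf (term i.succ))

attribute [instance] PolycyclicSeries.normal

/-- The factor `Gᵢ₊₁ / Gᵢ` of a polycyclic series. -/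
abbrev PolycyclicSeries.Factor {G : Type*} [Group G] [TopologicalSpace G]
    (s : PolycyclicSeries G) (i : Fin s.length) : Type _ :=
  s.term i.succ ⧸ (s.term i.castSucc).subgroupOf (s.term i.succ)

/-- The number of factors of the series that are isomorphic to `ℤ_p` (as topological groups). -/
noncomputable def PolycyclicSeries.hirschLength (p : ℕ) [Fact p.Prime] {G : Type*} [Group G]
    [TopologicalSpace G] (s : PolycyclicSeries G) : ℕ :=
  {i : Fin s.length | Nonempty (s.Factor i ≃ₜ* Multiplicative ℤ_[p])}.ncard

/-- `G` is polycyclic of Hirsch length `h`: it has a polycyclic series with exactly `h` factors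
isomorphic to `ℤ_p`. -/
def IsPolycyclicOfHirschLength (p : ℕ) [Fact p.Prime] (G : Type*) [Group G] [TopologicalSpace G]
    (h : ℕ) : Prop :=
  ∃ s : PolycyclicSeries G, s.hirschLength p = h

/-- `G` has an open abelian subgroup. -/
def IsVirtuallyAbelian (G : Type*) [Group G] [TopologicalSpace G] : Prop :=
  ∃ U : Subgroup G, IsOpen (U : Set G) ∧ ∀ x ∈ U, ∀ y ∈ U, x * y = y * x

/-- `G` is an extension of `ℤ_p × ℤ_p × ℤ_p` (the kernel) by the finite group `Q` (the quotient).
The kernel is compact and of finite index, hence open when `G` is profinite. -/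
def IsExtensionOfZpCubeBy (p : ℕ) [Fact p.Prime] (G : Type*) [Group G] [TopologicalSpace G]
    (Q : Type*) [Group Q] : Prop :=
  ∃ (N : Subgroup G) (_ : N.Normal),
    Nonempty (N ≃ₜ* Multiplicative (ℤ_[p] × ℤ_[p] × ℤ_[p])) ∧ Nonempty (G ⧸ N ≃* Q)

/-- The list of types of (torsion-free) virtually abelian pro-`p` groups of dimension three.
`DihedralGroup n` has order `2 * n` and `QuaternionGroup 4` has order `16`. -/
def HasVirtuallyAbelianType (p : ℕ) [Fact p.Prime] (G : Type*) [Group G] [TopologicalSpace G] :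
    Prop :=
  Nonempty (G ≃ₜ* Multiplicative (ℤ_[p] × ℤ_[p] × ℤ_[p])) ∨
  (p = 3 ∧ IsExtensionOfZpCubeBy p G (Multiplicative (ZMod 3))) ∨
  (p = 2 ∧
    (IsExtensionOfZpCubeBy p G (Multiplicative (ZMod 2)) ∨
      IsExtensionOfZpCubeBy p G (Multiplicative (ZMod 4)) ∨
      IsExtensionOfZpCubeBy p G (Multiplicative (ZMod 8)) ∨
      IsExtensionOfZpCubeBy p G (DihedralGroup 2) ∨
      IsExtensionOfZpCubeBy p G (DihedralGroup 4) ∨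
      IsExtensionOfZpCubeBy p G (DihedralGroup 8) ∨
      IsExtensionOfZpCubeBy p G (QuaternionGroup 4)))

/-- `G` is a semidirect product `(ℤ_p × ℤ_p) ⋊ ℤ_p` of closed subgroups. For compact subgroups
the bijection `A × C → G` is a homeomorphism onto a Hausdorff `G`, so that this is the
semidirect product of topological groups. -/
def IsZpSqSemidirectZp (p : ℕ) [Fact p.Prime] (G : Type*) [Group G] [TopologicalSpace G] : Prop :=
  ∃ A C : Subgroup G, A.Normal ∧ IsClosed (A : Set G) ∧ IsClosed (C : Set G) ∧
    A.IsComplement' C ∧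
    Nonempty (A ≃ₜ* Multiplicative (ℤ_[p] × ℤ_[p])) ∧ Nonempty (C ≃ₜ* Multiplicative ℤ_[p])

/-!
The terms of the series are normal in the whole group `G`, so `G` acts by conjugation on each
infinite factor `ℤ_p` through a character `G → ℤ_pˣ`. Finite factors are removed by passing to an
open normal subgroup: `G` has a chain `U₁ ≤ U₂ ≤ U₃` of closed normal subgroups with `U₃` open and
all factors isomorphic to `ℤ_p` (`IsPolycyclicOfHirschLength.exists_isZpChain`). The proof analyses
the characters `χ₁, χ₂, χ₃` of this chain.

A character either has values `1` and `-1`, or its square yields a homomorphism from `G` onto `ℤ_p`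
(`IsProP.character_dichotomy`), because the closed subgroups of `1 + pℤ_p`, respectively `1 + 4ℤ_2`,
are procyclic. Suppose that `χ₁`, or else `χ₂`, is of the second kind, and let `K` be the kernel of
the homomorphism to `ℤ_p`. It has dimension two and acts by signs on the factors of a two-step chain
of normal subgroups. An element acting by `-1` on both factors would have a power that it both fixes
and inverts, hence it would be torsion. So the elements of `K` that act trivially on both factors
form a subgroup `A` of index at most two in `K`. Its action on its open subgroup in the chain is
unipotent and of finite order, hence trivial. So the center of `A` has finite index and, as `A` is
torsion-free, `A` is abelian by the transfer (`HasNoTorsion.commute_of_relIndex_ne_zero`), which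
gives `A ≅ ℤ_p²`. Since `ℤ_p` is projective, `A` and a lift of a generator of `ℤ_p` generate a
subgroup `A ⋊ ℤ_p` of index at most two, which is alternative (ii)
(`hasZpSqSemidirectType_of_kernel`).

If `χ₁` and `χ₂` are signs, then, after shrinking the chain, `G` acts on `U₂ ≅ ℤ_p²` by triangular
matrices with diagonal `(χ₁, χ₂)`, and on the subgroup `χ₁ = χ₂`, of index at most two, the
off-diagonal entry times `χ₁` is a homomorphism to `ℤ_p`. If it is nonzero, its kernel is isomorphic
to `ℤ_p²`, and (ii) holds again. If it is zero, then `U₂` is virtually central and `G` is virtually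
abelian (`IsZpChain.exists_commutative`). In that case `χ₃` consists of signs as well, the common
kernel `M` of the three characters is isomorphic to `ℤ_p³`, and `G / M` is an elementary abelian
group of order at most four, as no element can act by `-1` on all three factors
(`IsZpChain.hasVirtuallyAbelianType`). As the subgroups of the series are normal in `G`, the only
quotients that occur are `1`, `C₂` and `D₂`.
-/

open Filter Topology

/-! ### `p`-adic powers in a pro-`p` group -/

section Powers

variable {p : ℕ} {G : Type*} [Group G] [TopologicalSpace G]

theorem IsProP.exists_openNormalSubgroup_subset (hG : IsProP p G) {S : Set G}
    (hS : S ∈ 𝓝 (1 : G)) :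
    ∃ U : Subgroup G, U.Normal ∧ IsOpen (U : Set G) ∧ (U : Set G) ⊆ S := by
  have := hG.isTopologicalGroup
  have := hG.compactSpace
  have := hG.totallyDisconnectedSpace
  obtain ⟨T, hTS, hT, h1⟩ := mem_nhds_iff.1 hS
  obtain ⟨U, hU⟩ := ProfiniteGrp.exist_openNormalSubgroup_sub_open_nhds_of_one hT h1
  exact ⟨U.toSubgroup, U.isNormal', U.isOpen', hU.trans hTS⟩

theorem IsProP.exists_pow_mem (hG : IsProP p G) {U : Subgroup G} (hUn : U.Normal)
    (hU : IsOpen (U : Set G)) (g : G) : ∃ n : ℕ, g ^ p ^ n ∈ U := by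
  obtain ⟨n, hn⟩ := hG.isPGroup_quotient U hU (g : G ⧸ U)
  exact ⟨n, (QuotientGroup.eq_one_iff _).1 (by simpa using hn)⟩

theorem IsProP.tendsto_pow (hG : IsProP p G) (g : G) :
    Tendsto (fun n : ℕ => g ^ p ^ n) atTop (𝓝 1) := by
  intro S hS
  obtain ⟨U, hUn, hU, hUS⟩ := hG.exists_openNormalSubgroup_subset hS
  obtain ⟨n, hn⟩ := hG.exists_pow_mem hUn hU g
  change ∀ᶠ m in atTop, g ^ p ^ m ∈ S
  filter_upwards [eventually_ge_atTop n] with m hm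
  obtain ⟨k, rfl⟩ := Nat.exists_eq_add_of_le hm
  exact hUS (by simpa [pow_add, pow_mul] using U.pow_mem hn (p ^ k))

/-- Closed subgroups of pro-`p` groups are pro-`p`. -/
theorem IsProP.subgroup (hG : IsProP p G) {H : Subgroup G} (hH : IsClosed (H : Set G)) :
    IsProP p H := by
  have := hG.isTopologicalGroup
  have := hG.compactSpace
  have := hG.t2Space
  have := hG.totallyDisconnectedSpace
  refine ⟨inferInstance, isCompact_iff_compactSpace.1 hH.isCompact, inferInstance, inferInstance,
    ?_⟩
  intro U hUn hU x
  obtain ⟨h, rfl⟩ := QuotientGroup.mk_surjective x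
  have ht : Tendsto (fun n : ℕ => h ^ p ^ n) atTop (𝓝 1) := by
    rw [tendsto_subtype_rng]
    simpa using hG.tendsto_pow (h : G)
  obtain ⟨n, hn⟩ := (ht.eventually (hU.mem_nhds U.one_mem)).exists
  exact ⟨n, by rw [← QuotientGroup.mk_pow]; exact (QuotientGroup.eq_one_iff _).2 hn⟩

variable [Fact p.Prime]

/-- The map `z ↦ g ^ z` extends from `ℤ` to `ℤ_p`. Its graph is the closure of the cyclic subgroup
generated by `(1, g)` in the compact group `ℤ_p × G`. -/
theorem IsProP.exists_padicPow (hG : IsProP p G) (g : G) :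
    ∃ e : ℤ_[p] → G, Continuous e ∧ (∀ x y, e (x + y) = e x * e y) ∧ e 1 = g := by
  have := hG.isTopologicalGroup
  have := hG.compactSpace
  have := hG.t2Space
  let D : Subgroup (Multiplicative ℤ_[p] × G) :=
    (Subgroup.zpowers (Multiplicative.ofAdd 1, g)).topologicalClosure
  have hDc : IsClosed (D : Set (Multiplicative ℤ_[p] × G)) := Subgroup.isClosed_topologicalClosure _
  have hmem : ∀ n : ℤ, ((Multiplicative.ofAdd (n : ℤ_[p])), g ^ n) ∈ D := fun n =>
    Subgroup.le_topologicalClosure _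
      ⟨n, by simp [← ofAdd_zsmul]⟩
  have hone : ∀ x : G, ((1 : Multiplicative ℤ_[p]), x) ∈ D → x = 1 := by
    intro x hx
    by_contra hx1
    obtain ⟨U, hUn, hU, hUS⟩ := hG.exists_openNormalSubgroup_subset
      (isOpen_compl_singleton.mem_nhds (Ne.symm hx1))
    apply hUS (show x ∈ (U : Set G) from ?_) rfl
    obtain ⟨n, hn⟩ := hG.exists_pow_mem hUn hU g
    let S : Set (Multiplicative ℤ_[p]) :=
      Multiplicative.toAdd ⁻¹' Metric.ball (0 : ℤ_[p]) ((p : ℝ) ^ (-(n : ℤ) + 1))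
    have hS : S ∈ 𝓝 (1 : Multiplicative ℤ_[p]) :=
      continuous_toAdd.continuousAt.preimage_mem_nhds
        (Metric.ball_mem_nhds _ (zpow_pos (by exact_mod_cast (Fact.out : p.Prime).pos) _))
    have hT : (fun y => x⁻¹ * y) ⁻¹' (U : Set G) ∈ 𝓝 x :=
      (continuous_const.mul continuous_id).continuousAt.preimage_mem_nhds
        (hU.mem_nhds (by simp [U.one_mem]))
    obtain ⟨y, ⟨hyS, hyT⟩, ⟨m, rfl⟩⟩ := mem_closure_iff_nhds.1 hx _ (prod_mem_nhds hS hT)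
    have hm : ‖((m : ℤ) : ℤ_[p])‖ ≤ (p : ℝ) ^ (-n : ℤ) := by
      rw [PadicInt.norm_le_pow_iff_norm_lt_pow_add_one]
      simpa [S] using hyS
    rw [PadicInt.norm_int_le_pow_iff_dvd] at hm
    obtain ⟨k, rfl⟩ := hm
    have hgm : g ^ ((p ^ n : ℕ) * k : ℤ) ∈ U := by
      rw [zpow_mul, zpow_natCast]
      exact U.zpow_mem hn k
    have h2 : x⁻¹ * g ^ ((p ^ n : ℕ) * k : ℤ) ∈ U := by simpa using hyT
    have := U.mul_mem hgm (U.inv_mem h2)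
    simpa using this
  have hsurj : ∀ z : Multiplicative ℤ_[p], ∃ x, (z, x) ∈ D := by
    have hcl : IsClosed (Prod.fst '' (D : Set (Multiplicative ℤ_[p] × G))) :=
      isClosedMap_fst_of_compactSpace _ hDc
    have hcl' : IsClosed (Multiplicative.ofAdd ⁻¹'
        (Prod.fst '' (D : Set (Multiplicative ℤ_[p] × G)))) := hcl.preimage continuous_ofAdd
    intro z
    have : Multiplicative.toAdd z ∈ Multiplicative.ofAdd ⁻¹'
        (Prod.fst '' (D : Set (Multiplicative ℤ_[p] × G))) :=
      PadicInt.denseRange_intCast.induction_on (p := fun z => z ∈ Multiplicative.ofAdd ⁻¹'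
        (Prod.fst '' (D : Set (Multiplicative ℤ_[p] × G)))) _ hcl' fun n => ⟨_, hmem n, rfl⟩
    obtain ⟨⟨z', x⟩, hx, rfl⟩ := this
    exact ⟨x, hx⟩
  have huniq : ∀ z x y, (z, x) ∈ D → (z, y) ∈ D → x = y := by
    intro z x y hx hy
    have := hone (x * y⁻¹) (by simpa using D.mul_mem hx (D.inv_mem hy))
    rwa [mul_inv_eq_one] at this
  choose e he using hsurj
  refine ⟨fun z => e (Multiplicative.ofAdd z), ?_, ?_, ?_⟩
  · refine Continuous.comp ?_ continuous_ofAdd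
    refine continuous_iff_isClosed.2 fun C hC => ?_
    have : e ⁻¹' C = Prod.fst '' ((D : Set (Multiplicative ℤ_[p] × G)) ∩ Prod.snd ⁻¹' C) := by
      ext z
      constructor
      · intro hz
        exact ⟨(z, e z), ⟨he z, hz⟩, rfl⟩
      · rintro ⟨⟨z', x⟩, ⟨hx, hxC⟩, rfl⟩
        have := huniq _ _ _ hx (he z')
        simpa [← this] using hxC
    rw [this]
    exact isClosedMap_fst_of_compactSpace _ (hDc.inter (hC.preimage continuous_snd))
  · intro x y
    exact huniq _ _ _ (he _) (by simpa using D.mul_mem (he (.ofAdd x)) (he (.ofAdd y)))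
  · exact huniq _ _ _ (he _) (by simpa using hmem 1)

end Powers

section PadicPow

variable {p : ℕ} [Fact p.Prime] {G : Type*} [Group G] {e : ℤ_[p] → G}

theorem padicPow_zero (he : ∀ x y, e (x + y) = e x * e y) : e 0 = 1 := by
  simpa using he 0 0

theorem padicPow_neg (he : ∀ x y, e (x + y) = e x * e y) (x : ℤ_[p]) : e (-x) = (e x)⁻¹ := by
  rw [eq_inv_iff_mul_eq_one, ← he, neg_add_cancel, padicPow_zero he]

theorem padicPow_natCast (he : ∀ x y, e (x + y) = e x * e y) (n : ℕ) : e n = e 1 ^ n := by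
  induction n with
  | zero => simpa using padicPow_zero he
  | succ n ih => rw [Nat.cast_succ, he, ih, pow_succ]

/-- A closed subgroup is closed under `p`-adic powers. -/
theorem padicPow_mem [TopologicalSpace G] (he : ∀ x y, e (x + y) = e x * e y) (hc : Continuous e)
    {B : Subgroup G} (hB : IsClosed (B : Set G)) (h1 : e 1 ∈ B) (z : ℤ_[p]) : e z ∈ B :=
  PadicInt.denseRange_natCast.induction_on (p := fun z => e z ∈ B) z (hB.preimage hc)
    fun n => by rw [padicPow_natCast he]; exact B.pow_mem h1 n

end PadicPow

/-! ### Continuous homomorphisms to `ℤ_p` defined on closed subgroups -/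

theorem PadicInt.dvd_of_norm_le_norm {p : ℕ} [Fact p.Prime] {x y : ℤ_[p]} (h : ‖x‖ ≤ ‖y‖) :
    y ∣ x := by
  by_cases hy : y = 0
  · rw [hy, norm_zero, norm_le_zero_iff] at h
    rw [h]
    exact dvd_zero y
  · have hy' : (y : ℚ_[p]) ≠ 0 := PadicInt.coe_ne_zero.2 hy
    refine ⟨⟨(x : ℚ_[p]) / y, ?_⟩, ?_⟩
    · rw [norm_div]
      exact div_le_one_of_le₀ (by simpa using h) (norm_nonneg _)
    · have h2 : (x : ℚ_[p]) = y * ((x : ℚ_[p]) / y) := by field_simp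
      exact PadicInt.ext h2

section PadicHom

variable {p : ℕ} [Fact p.Prime] {G : Type*} [Group G] [TopologicalSpace G]

/-- `f` restricts to a continuous homomorphism from the closed subgroup `B` to the additive group
`ℤ_p`. The values of `f` outside `B` are irrelevant; total functions avoid coercions between the
many subgroups involved. -/
structure IsPadicHomOn (B : Subgroup G) (f : G → ℤ_[p]) : Prop where
  isClosed : IsClosed (B : Set G)
  continuousOn : ContinuousOn f B
  map_mul : ∀ x ∈ B, ∀ y ∈ B, f (x * y) = f x + f y

/-- `B / A` is identified with `ℤ_p`: on the closed subgroup `B`, the function `ψ` is a continuous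
homomorphism onto `ℤ_p` with kernel `A`. Surjectivity is encoded by the value `1`, which suffices
by compactness. -/
structure IsZpFactor (A B : Subgroup G) (ψ : G → ℤ_[p]) : Prop extends IsPadicHomOn B ψ where
  le : A ≤ B
  eq_zero_iff : ∀ x ∈ B, ψ x = 0 ↔ x ∈ A
  exists_eq_one : ∃ b ∈ B, ψ b = 1

namespace IsPadicHomOn

variable {A B : Subgroup G} {f : G → ℤ_[p]}

theorem mono (hf : IsPadicHomOn B f) (hAB : A ≤ B) (hA : IsClosed (A : Set G)) :
    IsPadicHomOn A f :=
  ⟨hA, hf.continuousOn.mono hAB, fun x hx y hy => hf.map_mul x (hAB hx) y (hAB hy)⟩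

theorem map_one (hf : IsPadicHomOn B f) : f 1 = 0 := by
  simpa using hf.map_mul 1 B.one_mem 1 B.one_mem

theorem map_inv (hf : IsPadicHomOn B f) {x : G} (hx : x ∈ B) : f x⁻¹ = - f x := by
  have := hf.map_mul x hx x⁻¹ (B.inv_mem hx)
  rw [mul_inv_cancel, hf.map_one] at this
  exact eq_neg_of_add_eq_zero_right this.symm

theorem map_pow (hf : IsPadicHomOn B f) {x : G} (hx : x ∈ B) (n : ℕ) : f (x ^ n) = n * f x := by
  induction n with
  | zero => simp [hf.map_one]
  | succ n ih => rw [pow_succ, hf.map_mul _ (B.pow_mem hx n) _ hx, ih]; push_cast; ring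

theorem map_conj (hf : IsPadicHomOn B f) {x y : G} (hx : x ∈ B) (hy : y ∈ B) :
    f (x * y * x⁻¹) = f y := by
  rw [hf.map_mul _ (B.mul_mem hx hy) _ (B.inv_mem hx), hf.map_mul _ hx _ hy, hf.map_inv hx]
  ring

theorem map_padicPow (hf : IsPadicHomOn B f) {e : ℤ_[p] → G} (hc : Continuous e)
    (he : ∀ x y, e (x + y) = e x * e y) (h1 : e 1 ∈ B) (z : ℤ_[p]) : f (e z) = z * f (e 1) := by
  have hm := padicPow_mem he hc hf.isClosed h1
  have hcont : Continuous fun z => f (e z) := hf.continuousOn.comp_continuous hc hm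
  have := PadicInt.denseRange_natCast.equalizer hcont (continuous_mul_const (f (e 1)))
    (funext fun n => by simp [padicPow_natCast he, hf.map_pow h1])
  exact congrFun this z

/-- The kernel of a homomorphism defined on a closed subgroup, as a subgroup of the whole group. -/
def ker (hf : IsPadicHomOn B f) : Subgroup G where
  carrier := {x | x ∈ B ∧ f x = 0}
  mul_mem' := fun {x y} hx hy =>
    ⟨B.mul_mem hx.1 hy.1, by rw [hf.map_mul _ hx.1 _ hy.1, hx.2, hy.2, add_zero]⟩
  one_mem' := ⟨B.one_mem, hf.map_one⟩
  inv_mem' := fun {x} hx => ⟨B.inv_mem hx.1, by rw [hf.map_inv hx.1, hx.2, neg_zero]⟩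

theorem mem_ker (hf : IsPadicHomOn B f) {x : G} : x ∈ hf.ker ↔ x ∈ B ∧ f x = 0 := Iff.rfl

theorem isClosed_ker (hf : IsPadicHomOn B f) : IsClosed (hf.ker : Set G) := by
  have : (hf.ker : Set G) = (B : Set G) ∩ f ⁻¹' {0} := by
    ext x
    simp [mem_ker]
  rw [this]
  exact hf.continuousOn.preimage_isClosed_of_isClosed hf.isClosed isClosed_singleton

/-- The image of a nonzero continuous homomorphism to `ℤ_p` from a compact group is `cℤ_p` for some
nonzero `c`, so dividing by `c` makes it surjective. -/
theorem exists_rescale [CompactSpace G] (hf : IsPadicHomOn B f) (h0 : ∃ b ∈ B, f b ≠ 0) :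
    ∃ (f' : G → ℤ_[p]) (c : ℤ_[p]), c ≠ 0 ∧ (∀ x ∈ B, f x = c * f' x) ∧ IsPadicHomOn B f' ∧
      ∃ b ∈ B, f' b = 1 := by
  obtain ⟨b₀, hb₀, hmax⟩ := hf.isClosed.isCompact.exists_isMaxOn ⟨1, B.one_mem⟩
    (hf.continuousOn.norm)
  set c := f b₀ with hcdef
  have hc : c ≠ 0 := by
    obtain ⟨b, hb, hfb⟩ := h0
    have h1 : ‖f b‖ ≤ ‖c‖ := hmax hb
    intro h
    rw [h, norm_zero, norm_le_zero_iff] at h1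
    exact hfb h1
  have hdvd : ∀ x, ∃ y, x ∈ B → f x = c * y := by
    intro x
    by_cases hx : x ∈ B
    · have h1 : ‖f x‖ ≤ ‖c‖ := hmax hx
      obtain ⟨y, hy⟩ := PadicInt.dvd_of_norm_le_norm h1
      exact ⟨y, fun _ => hy⟩
    · exact ⟨0, fun h => absurd h hx⟩
  choose f' hf' using hdvd
  have hemb : IsClosedEmbedding fun z : ℤ_[p] => c * z :=
    (continuous_const_mul c).isClosedEmbedding (mul_right_injective₀ hc)
  refine ⟨f', c, hc, hf', ⟨hf.isClosed, ?_, ?_⟩, b₀, hb₀, ?_⟩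
  · rw [hemb.isInducing.continuousOn_iff]
    exact hf.continuousOn.congr fun x hx => (hf' x hx).symm
  · intro x hx y hy
    apply mul_left_cancel₀ hc
    rw [← hf' _ (B.mul_mem hx hy), hf.map_mul x hx y hy, hf' x hx, hf' y hy]
    ring
  · apply mul_left_cancel₀ hc
    rw [← hf' _ hb₀, mul_one]

end IsPadicHomOn

namespace IsZpFactor

variable {A B : Subgroup G} {ψ : G → ℤ_[p]}

theorem map_of_mem (h : IsZpFactor A B ψ) {x : G} (hx : x ∈ A) : ψ x = 0 :=
  (h.eq_zero_iff x (h.le hx)).2 hx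

theorem isClosed_left (h : IsZpFactor A B ψ) : IsClosed (A : Set G) := by
  have : A = h.toIsPadicHomOn.ker := by
    ext x
    rw [IsPadicHomOn.mem_ker]
    exact ⟨fun hx => ⟨h.le hx, h.map_of_mem hx⟩, fun hx => (h.eq_zero_iff x hx.1).1 hx.2⟩
  rw [this]
  exact h.toIsPadicHomOn.isClosed_ker

/-- Restriction of a `ℤ_p`-factor to a closed subgroup that is not contained in the kernel. -/
theorem restrict [CompactSpace G] (h : IsZpFactor A B ψ) {A' B' : Subgroup G}
    (hB' : IsClosed (B' : Set G)) (hle : B' ≤ B) (hA' : ∀ x ∈ B', x ∈ A' ↔ x ∈ A) (hAB : A' ≤ B')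
    (hne : ∃ b ∈ B', b ∉ A) : ∃ ψ' : G → ℤ_[p], IsZpFactor A' B' ψ' := by
  have hr := h.toIsPadicHomOn.mono hle hB'
  obtain ⟨ψ', c, hc, hcψ, hψ', h1⟩ := hr.exists_rescale (by
    obtain ⟨b, hb, hbA⟩ := hne
    exact ⟨b, hb, fun h0 => hbA ((h.eq_zero_iff b (hle hb)).1 h0)⟩)
  refine ⟨ψ', hψ', hAB, fun x hx => ?_, h1⟩
  rw [hA' x hx, ← h.eq_zero_iff x (hle hx), hcψ x hx, mul_eq_zero, or_iff_right hc]

/-- The subgroup generated by `A` and the closure of one generator modulo `A` is everything. -/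
theorem le_of_mem (hG : IsProP p G) (h : IsZpFactor A B ψ) {D : Subgroup G}
    (hD : IsClosed (D : Set G)) (hAD : A ≤ D) {b : G} (hb : b ∈ B) (hb1 : ψ b = 1) (hbD : b ∈ D) :
    B ≤ D := by
  intro x hx
  obtain ⟨e, hc, he, rfl⟩ := hG.exists_padicPow b
  have h1 := padicPow_mem he hc h.isClosed hb (ψ x)
  have h2 := padicPow_mem he hc hD hbD (ψ x)
  have h3 : ψ (x * (e (ψ x))⁻¹) = 0 := by
    rw [h.map_mul _ hx _ (B.inv_mem h1), h.toIsPadicHomOn.map_inv h1,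
      h.toIsPadicHomOn.map_padicPow hc he hb, hb1]
    ring
  have h4 := (h.eq_zero_iff _ (B.mul_mem hx (B.inv_mem h1))).1 h3
  simpa using D.mul_mem (hAD h4) h2

/-- A homomorphism to `ℤ_p` that vanishes on `A` is proportional to the one that identifies `B / A`
with `ℤ_p`. -/
theorem proportional (hG : IsProP p G) (h : IsZpFactor A B ψ) {B' : Subgroup G} (hle : B' ≤ B)
    {c : G → ℤ_[p]} (hc : IsPadicHomOn B' c) (h0 : ∀ x ∈ B', x ∈ A → c x = 0) {x y : G}
    (hx : x ∈ B') (hy : y ∈ B') : ψ y * c x = ψ x * c y := by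
  have := hG.compactSpace
  by_cases hne : ∃ b ∈ B', b ∉ A
  · obtain ⟨b₁, hb₁, hb₁A⟩ := hne
    have hr := h.toIsPadicHomOn.mono hle hc.isClosed
    obtain ⟨ψ', k, hk, hkψ, hψ', b, hb, hb1⟩ := hr.exists_rescale
      ⟨b₁, hb₁, fun h0 => hb₁A ((h.eq_zero_iff b₁ (hle hb₁)).1 h0)⟩
    have key : ∀ x ∈ B', c x = ψ' x * c b := by
      intro x hx
      obtain ⟨e, hec, he, rfl⟩ := hG.exists_padicPow b
      have h1 := padicPow_mem he hec hc.isClosed hb (ψ' x)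
      have h2 : x * (e (ψ' x))⁻¹ ∈ B' := B'.mul_mem hx (B'.inv_mem h1)
      have h3 : ψ (x * (e (ψ' x))⁻¹) = 0 := by
        rw [hkψ _ h2, hψ'.map_mul _ hx _ (B'.inv_mem h1), hψ'.map_inv h1,
          hψ'.map_padicPow hec he hb, hb1]
        ring
      have h4 := h0 _ h2 ((h.eq_zero_iff _ (hle h2)).1 h3)
      rw [hc.map_mul _ hx _ (B'.inv_mem h1), hc.map_inv h1, hc.map_padicPow hec he hb] at h4
      linear_combination h4
    rw [hkψ x hx, hkψ y hy, key x hx, key y hy]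
    ring
  · push Not at hne
    rw [h0 x hx (hne x hx), h0 y hy (hne y hy), mul_zero, mul_zero]

/-- The action of the group by conjugation on a `ℤ_p`-factor is given by a continuous character. -/
theorem exists_character (hG : IsProP p G) (h : IsZpFactor A B ψ) (hA : A.Normal) (hB : B.Normal) :
    ∃ χ : G →* ℤ_[p], Continuous χ ∧ ∀ g, ∀ b ∈ B, ψ (g * b * g⁻¹) = χ g * ψ b := by
  have := hG.isTopologicalGroup
  obtain ⟨b₀, hb₀, hb1⟩ := h.exists_eq_one
  have key : ∀ g, ∀ b ∈ B, ψ (g * b * g⁻¹) = ψ (g * b₀ * g⁻¹) * ψ b := by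
    intro g b hb
    have hc : IsPadicHomOn B fun b => ψ (g * b * g⁻¹) := by
      refine ⟨h.isClosed, ?_, ?_⟩
      · exact h.continuousOn.comp (by fun_prop) fun x hx => hB.conj_mem x hx g
      · intro x hx y hy
        rw [← h.map_mul _ (hB.conj_mem x hx g) _ (hB.conj_mem y hy g)]
        congr 1
        group
    have := h.proportional hG le_rfl hc
      (fun x _ hxA => h.map_of_mem (hA.conj_mem x hxA g)) hb hb₀
    rw [hb1] at this
    linear_combination this
  refine ⟨⟨⟨fun g => ψ (g * b₀ * g⁻¹), by simp [hb1]⟩, ?_⟩, ?_, key⟩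
  · intro g g'
    rw [← key g _ (hB.conj_mem b₀ hb₀ g')]
    simp [mul_assoc]
  · exact h.continuousOn.comp_continuous (by fun_prop) fun g => hB.conj_mem b₀ hb₀ g

end IsZpFactor

end PadicHom

/-! ### Characters of pro-`p` groups with values in `ℤ_p` -/

section Characters

variable {p : ℕ} [Fact p.Prime]

/-- Every `v` with `u - 1 ∣ v - 1` is a `p`-adic limit of powers of `u`, provided that `u - 1` is
divisible by `p`, and by `4` if `p = 2`. -/
theorem PadicInt.exists_pow_sub_dvd {c v : ℤ_[p]} (hpc : (p : ℤ_[p]) ∣ c)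
    (hc : (p : ℤ_[p]) * c * p ∣ c ^ p) (hv : c ∣ v - 1) (n : ℕ) :
    ∃ k : ℕ, (p : ℤ_[p]) ^ n * c ∣ v - (1 + c) ^ k := by
  induction n with
  | zero => exact ⟨0, by simpa using hv⟩
  | succ n ih =>
    obtain ⟨k, a, hk⟩ := ih
    obtain ⟨y, hy⟩ := ZMod.exists_one_add_mul_pow_prime_pow_eq (Fact.out : p.Prime) hpc hc 1 n
    rw [mul_one] at hy
    -- the correct exponent is determined modulo `p` by the residue of the current error
    obtain ⟨j, hj⟩ : ∃ j : ℕ, (p : ℤ_[p]) ∣ a - j := by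
      refine ⟨a.zmodRepr, ?_⟩
      rw [← PadicInt.norm_lt_one_iff_dvd, ← PadicInt.mem_nonunits]
      exact PadicInt.sub_zmodRepr_mem a
    obtain ⟨t, ht⟩ := hj
    obtain ⟨d, rfl⟩ := hpc
    obtain ⟨r, hr⟩ : ∃ r, (1 + (p : ℤ_[p]) * d) ^ k = 1 + p * r := by
      obtain ⟨r, hr⟩ := sub_one_dvd_pow_sub_one (1 + (p : ℤ_[p]) * d) k
      exact ⟨d * r, by linear_combination hr⟩
    obtain ⟨s, hs⟩ : ∃ s, (1 + (p : ℤ_[p]) ^ n * (p * d) * (1 + p * y)) ^ j =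
        1 + j * ((p : ℤ_[p]) ^ n * (p * d) * (1 + p * y)) +
          ((p : ℤ_[p]) ^ n * (p * d) * (1 + p * y)) ^ 2 * s := by
      generalize (p : ℤ_[p]) ^ n * (p * d) * (1 + p * y) = x
      clear * -
      induction j with
      | zero => exact ⟨0, by simp⟩
      | succ j ih =>
        obtain ⟨s, hs⟩ := ih
        exact ⟨j + s * (1 + x), by rw [pow_succ, hs]; push_cast; ring⟩
    refine ⟨k + p ^ n * j, ?_⟩
    rw [pow_add (1 + (p : ℤ_[p]) * d), pow_mul, hy, hs, hr]
    have ha : a = j + p * t := by linear_combination ht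
    have hv : v = (1 + p * r) + p ^ n * (p * d) * (j + p * t) := by
      rw [← ha, ← hk, hr]; ring
    rw [hv]
    refine ⟨t - j * y - r * j * (1 + p * y)
      - (1 + p * r) * ((p : ℤ_[p]) ^ n * d * (1 + p * y) ^ 2) * s, ?_⟩
    ring

variable {G : Type*} [Group G] [TopologicalSpace G]

/-- By Fermat's little theorem and `g ^ p ^ n → 1`, a continuous character of a pro-`p` group is
trivial modulo `p`. -/
theorem IsProP.dvd_character_sub_one (hG : IsProP p G) {χ : G →* ℤ_[p]} (hχ : Continuous χ)
    (g : G) : (p : ℤ_[p]) ∣ χ g - 1 := by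
  have ht : Tendsto (fun n : ℕ => χ (g ^ p ^ n)) atTop (𝓝 1) := by
    have := (hχ.tendsto 1).comp (hG.tendsto_pow g)
    rwa [map_one] at this
  obtain ⟨n, hn⟩ := (ht.eventually (Metric.ball_mem_nhds 1 one_pos)).exists
  rw [dist_eq_norm, PadicInt.norm_lt_one_iff_dvd, map_pow] at hn
  have key : ∀ x : ℤ_[p], (p : ℤ_[p]) ∣ x ↔ PadicInt.toZMod x = 0 := by
    intro x
    rw [← RingHom.mem_ker, PadicInt.ker_toZMod, PadicInt.maximalIdeal_eq_span_p,
      Ideal.mem_span_singleton]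
  rw [key] at hn ⊢
  rwa [map_sub, map_pow, ZMod.pow_card_pow, ← map_sub] at hn

theorem IsProP.character_eq_one_of_sq (hG : IsProP p G) (hp : p ≠ 2) {χ : G →* ℤ_[p]}
    (hχ : Continuous χ) {g : G} (h : χ g ^ 2 = 1) : χ g = 1 := by
  rcases mul_self_eq_one_iff.1 ((pow_two (χ g)).symm.trans h) with h | h
  · exact h
  · exfalso
    have h1 := hG.dvd_character_sub_one hχ g
    rw [h, show (-1 - 1 : ℤ_[p]) = ((-2 : ℤ) : ℤ_[p]) by norm_num,
      ← PadicInt.norm_lt_one_iff_dvd, PadicInt.norm_int_lt_one_iff_dvd, dvd_neg] at h1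
    exact hp ((Nat.prime_dvd_prime_iff_eq Fact.out Nat.prime_two).1 (by exact_mod_cast h1))

/-- A continuous character of a pro-`p` group has values in `{1, -1}`, or it gives rise to a
homomorphism onto `ℤ_p`. Indeed, if `u = χ(g)²` is chosen with `|u - 1|` as large as possible, then
`z ↦ u ^ z` is an isomorphism from `ℤ_p` onto the group of values of `χ²`. -/
theorem IsProP.character_dichotomy (hG : IsProP p G) {χ : G →* ℤ_[p]} (hχ : Continuous χ) :
    (∀ g, χ g ^ 2 = 1) ∨
    ∃ φ : G → ℤ_[p], IsPadicHomOn ⊤ φ ∧ (∃ g, φ g = 1) ∧ ∀ g, φ g = 0 ↔ χ g ^ 2 = 1 := by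
  have := hG.isTopologicalGroup
  have := hG.compactSpace
  have := hG.t2Space
  by_cases h1 : ∀ g, χ g ^ 2 = 1
  · exact Or.inl h1
  right
  push Not at h1
  obtain ⟨g₁, hg₁⟩ := h1
  have hcont : Continuous fun g => ‖χ g ^ 2 - 1‖ := by fun_prop
  obtain ⟨g₀, -, hmax⟩ := isCompact_univ.exists_isMaxOn ⟨(1 : G), trivial⟩ hcont.continuousOn
  obtain ⟨c, hc⟩ : ∃ c, χ g₀ ^ 2 = 1 + c := ⟨χ g₀ ^ 2 - 1, by ring⟩
  have hdvd : ∀ g, c ∣ χ g ^ 2 - 1 := fun g => PadicInt.dvd_of_norm_le_norm (by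
    have : ‖χ g ^ 2 - 1‖ ≤ ‖χ g₀ ^ 2 - 1‖ := hmax (Set.mem_univ g)
    simpa [hc] using this)
  have hc0 : c ≠ 0 := by
    rintro rfl
    exact hg₁ (sub_eq_zero.1 (zero_dvd_iff.1 (hdvd g₁)))
  obtain ⟨d, hd⟩ := hG.dvd_character_sub_one hχ g₀
  have hcd : c = p * d * (2 + p * d) := by linear_combination (χ g₀ + p * d + 1) * hd - hc
  have hpc : (p : ℤ_[p]) ∣ c := ⟨d * (2 + p * d), by rw [hcd]; ring⟩
  have hcp : (p : ℤ_[p]) * c * p ∣ c ^ p := by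
    by_cases hp : p = 2
    · subst hp
      exact ⟨d * (1 + d), by rw [pow_two]; nth_rw 2 [hcd]; push_cast; ring⟩
    · obtain ⟨k, hk⟩ : ∃ k, p = k + 3 := Nat.exists_eq_add_of_le'
        (by have := (Fact.out : p.Prime).two_le; omega)
      obtain ⟨r, hr⟩ := hpc
      have : c ^ p = c * (c * c) * c ^ k := by
        rw [congrArg (c ^ ·) hk]
        ring
      refine ⟨r * r * c ^ k, ?_⟩
      rw [this]
      nth_rw 2 3 [hr]
      ring
  obtain ⟨e, hec, he, rfl⟩ := hG.exists_padicPow g₀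
  -- `F z` is `u ^ z` for `u = 1 + c`
  let F : ℤ_[p] → ℤ_[p] := fun z => χ (e z) ^ 2
  have hFc : Continuous F := by fun_prop
  have hFadd : ∀ x y, F (x + y) = F x * F y := fun x y => by
    simp only [F, he, map_mul, mul_pow]
  have hF0 : F 0 = 1 := by simp [F, padicPow_zero he]
  have hFnat : ∀ n : ℕ, F n = (1 + c) ^ n := fun n => by
    simp only [F, padicPow_natCast he, map_pow, ← hc]
    rw [← pow_mul, ← pow_mul, mul_comm]
  have hFmul : ∀ x y, F x = 1 → F (y * x) = 1 := by
    intro x y hx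
    have hcl : IsClosed {y | F (y * x) = 1} :=
      isClosed_eq (hFc.comp (continuous_mul_const x)) continuous_const
    refine PadicInt.denseRange_natCast.induction_on (p := fun y => F (y * x) = 1) y hcl ?_
    intro n
    induction n with
    | zero => simpa using hF0
    | succ n ih => rw [Nat.cast_succ, add_mul, one_mul, hFadd, ih, hx, one_mul]
  have hFker : ∀ x, F x = 1 → x = 0 := by
    intro x hx
    by_contra hx0
    have hpow : F ((p ^ x.valuation : ℕ) : ℤ_[p]) = 1 := by
      have := hFmul x ((PadicInt.unitCoeff hx0)⁻¹ : ℤ_[p]ˣ) hx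
      nth_rw 2 [PadicInt.unitCoeff_spec hx0] at this
      rw [Units.inv_mul_cancel_left] at this
      exact_mod_cast this
    obtain ⟨y, hy⟩ := ZMod.exists_one_add_mul_pow_prime_pow_eq (Fact.out : p.Prime) hpc hcp 1
      x.valuation
    rw [mul_one] at hy
    rw [hFnat, hy, add_eq_left, mul_eq_zero, mul_eq_zero, or_iff_right] at hpow
    · have : IsUnit (1 + (p : ℤ_[p]) * y) := by
        by_contra hu
        rw [hpow, PadicInt.not_isUnit_iff] at hu
        have h3 : ‖(1 : ℤ_[p])‖ < 1 := by
          rw [PadicInt.norm_lt_one_iff_dvd]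
          exact ⟨-y, by linear_combination hpow⟩
        simp at h3
      rw [hpow] at this
      exact not_isUnit_zero this
    · rintro (h | h)
      · exact pow_ne_zero _ (by exact_mod_cast (Fact.out : p.Prime).ne_zero) h
      · exact hc0 h
  have hFinj : Function.Injective F := by
    intro x y hxy
    have h2 : F (x - y) = 1 := by
      have h3 : F (x - y) * F y = F y := by rw [← hFadd, sub_add_cancel, hxy]
      have h4 : F (-y) * F y = 1 := by rw [← hFadd, neg_add_cancel, hF0]
      calc F (x - y) = F (x - y) * F y * F (-y) := by rw [mul_assoc, mul_comm (F y), h4, mul_one]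
        _ = 1 := by rw [h3, mul_comm, h4]
    exact sub_eq_zero.1 (hFker _ h2)
  have hemb : IsClosedEmbedding F := hFc.isClosedEmbedding hFinj
  have hFsurj : ∀ g, ∃ z, F z = χ g ^ 2 := by
    intro g
    have : χ g ^ 2 ∈ closure (Set.range F) := by
      rw [Metric.mem_closure_range_iff]
      intro ε hε
      obtain ⟨n, hn⟩ := PadicInt.exists_pow_neg_lt p hε
      obtain ⟨k, t, hk⟩ := PadicInt.exists_pow_sub_dvd hpc hcp (hdvd g) n
      refine ⟨k, ?_⟩
      rw [hFnat, dist_eq_norm, hk, norm_mul, norm_mul, PadicInt.norm_p_pow]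
      refine lt_of_le_of_lt ?_ hn
      rw [mul_assoc]
      exact mul_le_of_le_one_right (zpow_nonneg (Nat.cast_nonneg p) _)
        (mul_le_one₀ (PadicInt.norm_le_one _) (norm_nonneg _) (PadicInt.norm_le_one _))
    rwa [hemb.isClosed_range.closure_eq] at this
  choose φ hφ using hFsurj
  refine ⟨φ, ⟨by simp, ?_, ?_⟩, ⟨e 1, hFinj ?_⟩, ?_⟩
  · rw [Subgroup.coe_top, continuousOn_univ, hemb.isInducing.continuous_iff]
    exact (hχ.pow 2).congr fun g => (hφ g).symm
  · intro x _ y _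
    apply hFinj
    rw [hFadd, hφ, hφ, hφ, map_mul, mul_pow]
  · rw [hφ]
  · intro g
    rw [← hφ g]
    exact ⟨fun h => by rw [h, hF0], fun h => hFker _ h⟩

/-- The values of finite order of a character are `1` and `-1`. -/
theorem IsProP.character_sq_eq_one_of_pow (hG : IsProP p G) {χ : G →* ℤ_[p]} (hχ : Continuous χ)
    {g : G} {n : ℕ} (hn : n ≠ 0) (h : χ g ^ n = 1) : χ g ^ 2 = 1 := by
  rcases hG.character_dichotomy hχ with h1 | ⟨φ, hφ, -, hφχ⟩
  · exact h1 g
  · have h2 : φ (g ^ n) = 0 := by rw [hφχ, map_pow, h, one_pow]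
    rw [hφ.map_pow (Subgroup.mem_top g), mul_eq_zero, or_iff_right (by exact_mod_cast hn)] at h2
    exact (hφχ g).1 h2

end Characters

/-! ### Commutation in torsion-free groups -/

section Commute

variable {p : ℕ} [Fact p.Prime] {G : Type*} [Group G]

theorem HasNoTorsion.eq_one_of_pow (htf : HasNoTorsion G) {g : G} {n : ℕ} (hn : n ≠ 0)
    (h : g ^ n = 1) : g = 1 :=
  htf g (isOfFinOrder_iff_pow_eq_one.2 ⟨n, Nat.pos_of_ne_zero hn, h⟩)

/-- A torsion-free group with a central subgroup of finite index is commutative: the transfer to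
the center is a power map, hence injective. -/
theorem HasNoTorsion.commute_of_relIndex_ne_zero (htf : HasNoTorsion G) {K V : Subgroup G}
    (hV : V.relIndex K ≠ 0) (hVK : ∀ v ∈ V, ∀ k ∈ K, v * k = k * v) :
    ∀ x ∈ K, ∀ y ∈ K, x * y = y * x := by
  have hle : V.subgroupOf K ≤ Subgroup.center K := by
    intro v hv
    rw [Subgroup.mem_center_iff]
    intro k
    exact Subtype.ext (hVK v hv k k.2).symm
  have : (V.subgroupOf K).FiniteIndex := ⟨hV⟩
  have : (Subgroup.center K).FiniteIndex := Subgroup.finiteIndex_of_le hle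
  have hinj : Function.Injective (MonoidHom.transferCenterPow K) := by
    rw [injective_iff_map_eq_one]
    intro x hx
    have h1 : x ^ (Subgroup.center K).index = 1 := by
      rw [← MonoidHom.transferCenterPow_apply, hx, Subgroup.coe_one]
    exact Subtype.ext
      (htf.eq_one_of_pow this.index_ne_zero (by exact_mod_cast congrArg Subtype.val h1))
  intro x hx y hy
  have h2 : (⟨x, hx⟩ : K) * ⟨y, hy⟩ = ⟨y, hy⟩ * ⟨x, hx⟩ :=
    hinj (by
      rw [map_mul, map_mul]
      exact Subtype.ext (Subgroup.mem_center_iff.1 (SetLike.coe_mem _) _))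
  exact congrArg Subtype.val h2

variable [TopologicalSpace G] {A B : Subgroup G} {ψ : G → ℤ_[p]}

/-- An extension of `ℤ_p` by a central subgroup is commutative. -/
theorem IsZpFactor.commute_of_central (hG : IsProP p G) (h : IsZpFactor A B ψ)
    (hA : ∀ a ∈ A, ∀ b ∈ B, a * b = b * a) : ∀ x ∈ B, ∀ y ∈ B, x * y = y * x := by
  have := hG.isTopologicalGroup
  have := hG.t2Space
  obtain ⟨b, hb, hb1⟩ := h.exists_eq_one
  have h1 : B ≤ Subgroup.centralizer {b} := by
    refine h.le_of_mem hG (Set.isClosed_centralizer _) ?_ hb hb1 ?_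
    · intro a ha
      rw [Subgroup.mem_centralizer_singleton_iff]
      exact hA a ha b hb
    · rw [Subgroup.mem_centralizer_singleton_iff]
  have h2 : B ≤ Subgroup.centralizer B := by
    refine h.le_of_mem hG (Set.isClosed_centralizer _) ?_ hb hb1 ?_
    · intro a ha
      rw [Subgroup.mem_centralizer_iff]
      exact fun x hx => (hA a ha x hx).symm
    · rw [Subgroup.mem_centralizer_iff]
      exact fun x hx => Subgroup.mem_centralizer_singleton_iff.1 (h1 hx)
  intro x hx y hy
  exact (Subgroup.mem_centralizer_iff.1 (h2 hx) y hy).symm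

/-- An element of a torsion-free group that acts unipotently and with finite order on a normal
subgroup acts trivially. -/
theorem IsZpFactor.commute_of_pow (htf : HasNoTorsion G) (h : IsZpFactor A B ψ) (hB : B.Normal)
    {g : G} (hA : ∀ a ∈ A, g * a = a * g) (hψ : ∀ b ∈ B, ψ (g * b * g⁻¹) = ψ b) {n : ℕ}
    (hn : n ≠ 0) {b : G} (hb : b ∈ B) (hgn : g ^ n * b = b * g ^ n) : g * b = b * g := by
  have h1 := hB.conj_mem b hb g
  set c := g * b * g⁻¹ * b⁻¹ with hc
  have hcA : c ∈ A := by
    rw [← h.eq_zero_iff _ (B.mul_mem h1 (B.inv_mem hb)), h.map_mul _ h1 _ (B.inv_mem hb), hψ b hb,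
      h.toIsPadicHomOn.map_inv hb, add_neg_cancel]
  have hgb : g * b = c * b * g := by simp [hc]
  have key : ∀ k : ℕ, g ^ k * b = c ^ k * b * g ^ k := by
    intro k
    induction k with
    | zero => simp
    | succ k ih =>
      have hck : g * c ^ k = c ^ k * g := (show Commute g c from hA c hcA).pow_right k
      rw [pow_succ', mul_assoc, ih, ← mul_assoc, ← mul_assoc, hck, mul_assoc (c ^ k), hgb,
        pow_succ c]
      simp only [mul_assoc]
  have h2 : c ^ n = 1 := by
    have := (key n).symm.trans hgn
    rw [mul_assoc] at this
    exact mul_eq_right.1 this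
  rw [hgb, htf.eq_one_of_pow hn h2, one_mul]

end Commute

/-! ### Recognition of `ℤ_p`-lattices -/

section Lattices

/-- Compact groups that embed into a common group with the same image are isomorphic. -/
theorem nonempty_continuousMulEquiv_of_range_eq {X Y Z : Type*} [Group X] [Group Y] [Group Z]
    [TopologicalSpace X] [TopologicalSpace Y] [TopologicalSpace Z] [CompactSpace X]
    [CompactSpace Y] [T2Space Z] {f : X →* Z} {g : Y →* Z} (hf : Continuous f) (hg : Continuous g)
    (hfi : Function.Injective f) (hgi : Function.Injective g) (h : f.range = g.range) :
    Nonempty (X ≃ₜ* Y) := by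
  let e : X ≃* Y := (f.ofInjective hfi).trans
    ((MulEquiv.subgroupCongr h).trans (g.ofInjective hgi).symm)
  have hge : ∀ x, g (e x) = f x := fun x => by
    have : (g.ofInjective hgi) (e x) = MulEquiv.subgroupCongr h (f.ofInjective hfi x) :=
      MulEquiv.apply_symm_apply _ _
    exact congrArg Subtype.val this
  refine ⟨{ e with continuous_toFun := ?_, continuous_invFun := ?_ }⟩
  · change Continuous e
    rw [(hg.isClosedEmbedding hgi).isInducing.continuous_iff]
    exact hf.congr fun x => (hge x).symm
  · change Continuous e.symm
    rw [(hf.isClosedEmbedding hfi).isInducing.continuous_iff]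
    exact hg.congr fun y => by simp [← hge]

variable {p : ℕ} [Fact p.Prime] {G : Type*} [Group G] [TopologicalSpace G] {A B : Subgroup G}
  {ψ : G → ℤ_[p]}

theorem IsZpFactor.nonempty_continuousMulEquiv_of_bot [CompactSpace G]
    (h : IsZpFactor ⊥ B ψ) (hG : IsProP p G) : Nonempty (B ≃ₜ* Multiplicative ℤ_[p]) := by
  have : CompactSpace B := isCompact_iff_compactSpace.1 h.isClosed.isCompact
  let f : B →* Multiplicative ℤ_[p] :=
    { toFun := fun x => .ofAdd (ψ x)
      map_one' := by simp [h.toIsPadicHomOn.map_one]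
      map_mul' := fun x y => by simp [h.map_mul x x.2 y y.2] }
  refine nonempty_continuousMulEquiv_of_range_eq (f := f) (g := MonoidHom.id _) ?_ continuous_id
    ?_ Function.injective_id ?_
  · exact continuous_ofAdd.comp (continuousOn_iff_continuous_domRestrict.1 h.continuousOn)
  · rw [injective_iff_map_eq_one]
    intro x hx
    have : ψ x = 0 := ofAdd_eq_one.1 hx
    exact Subtype.ext ((h.eq_zero_iff x x.2).1 this)
  · rw [MonoidHom.range_eq_top.2, MonoidHom.range_eq_top.2 Function.surjective_id]
    intro z
    obtain ⟨b, hb, hb1⟩ := h.exists_eq_one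
    obtain ⟨e, hc, he, rfl⟩ := hG.exists_padicPow b
    refine ⟨⟨e z.toAdd, padicPow_mem he hc h.isClosed hb _⟩, ?_⟩
    apply Multiplicative.toAdd.injective
    change ψ (e z.toAdd) = z.toAdd
    rw [h.toIsPadicHomOn.map_padicPow hc he hb, hb1, mul_one]

/-- Commutative extensions of `ℤ_p` split. -/
theorem IsZpFactor.nonempty_continuousMulEquiv_prod (h : IsZpFactor A B ψ) (hG : IsProP p G)
    (hB : ∀ x ∈ B, ∀ y ∈ B, x * y = y * x) {E : Type*} [AddCommGroup E] [TopologicalSpace E]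
    [CompactSpace E] (hE : Nonempty (A ≃ₜ* Multiplicative E)) :
    Nonempty (B ≃ₜ* Multiplicative (ℤ_[p] × E)) := by
  have := hG.isTopologicalGroup
  have := hG.compactSpace
  have := hG.t2Space
  have : CompactSpace B := isCompact_iff_compactSpace.1 h.isClosed.isCompact
  have : CompactSpace (Multiplicative (ℤ_[p] × E)) :=
    inferInstanceAs (CompactSpace (ℤ_[p] × E))
  obtain ⟨i⟩ := hE
  obtain ⟨b, hb, hb1⟩ := h.exists_eq_one
  obtain ⟨e, hc, he, rfl⟩ := hG.exists_padicPow b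
  have heB := padicPow_mem he hc h.isClosed hb
  let f : Multiplicative (ℤ_[p] × E) →* B :=
    { toFun := fun z => ⟨e z.toAdd.1, heB _⟩ * Subgroup.inclusion h.le (i.symm (.ofAdd z.toAdd.2))
      map_one' := by
        have : (⟨e 0, heB 0⟩ : B) = 1 := Subtype.ext (padicPow_zero he)
        simp [this]
      map_mul' := fun x y => by
        have h1 : (⟨e (x.toAdd.1 + y.toAdd.1), heB _⟩ : B) =
          ⟨e x.toAdd.1, heB _⟩ * ⟨e y.toAdd.1, heB _⟩ := Subtype.ext (he _ _)
        have hcomm : ∀ x y : B, x * y = y * x := fun x y => Subtype.ext (hB x x.2 y y.2)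
        simp only [toAdd_mul, Prod.fst_add, Prod.snd_add, ofAdd_add, map_mul, h1]
        rw [mul_assoc, mul_assoc]
        congr 1
        rw [← mul_assoc, ← mul_assoc]
        congr 1
        exact hcomm _ _ }
  have hψf : ∀ z, ψ (f z) = z.toAdd.1 := fun z => by
    change ψ (e z.toAdd.1 * (i.symm (.ofAdd z.toAdd.2) : G)) = _
    rw [h.map_mul _ (heB _) _ (h.le (SetLike.coe_mem _)), h.map_of_mem (SetLike.coe_mem _),
      h.toIsPadicHomOn.map_padicPow hc he hb, hb1]
    ring
  refine (nonempty_continuousMulEquiv_of_range_eq (f := f) (g := MonoidHom.id _) ?_ continuous_id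
    ?_ Function.injective_id ?_).map ContinuousMulEquiv.symm
  · have h1 : Continuous fun z : Multiplicative (ℤ_[p] × E) => z.toAdd.1 :=
      continuous_fst.comp continuous_toAdd
    have h2 : Continuous fun z : Multiplicative (ℤ_[p] × E) => Multiplicative.ofAdd z.toAdd.2 :=
      continuous_ofAdd.comp (continuous_snd.comp continuous_toAdd)
    refine Continuous.mul ((hc.comp h1).subtype_mk _) ?_
    exact (continuous_subtype_val.comp (i.symm.continuous.comp h2)).subtype_mk _
  · rw [injective_iff_map_eq_one]
    intro z hz
    have h1 : z.toAdd.1 = 0 := by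
      rw [← hψf, hz]
      exact h.toIsPadicHomOn.map_one
    have h2 : i.symm (.ofAdd z.toAdd.2) = 1 := by
      have h3 : e z.toAdd.1 * (i.symm (.ofAdd z.toAdd.2) : G) = 1 := congrArg Subtype.val hz
      rw [h1, padicPow_zero he, one_mul] at h3
      exact Subtype.ext h3
    rw [map_eq_one_iff i.symm i.symm.injective, ofAdd_eq_one] at h2
    exact Multiplicative.toAdd.injective (Prod.ext h1 h2)
  · rw [MonoidHom.range_eq_top.2, MonoidHom.range_eq_top.2 Function.surjective_id]
    intro x
    have h1 : (e (ψ x))⁻¹ * x ∈ B := B.mul_mem (B.inv_mem (heB _)) x.2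
    have h2 : (e (ψ x))⁻¹ * x ∈ A := by
      rw [← h.eq_zero_iff _ h1, h.map_mul _ (B.inv_mem (heB _)) _ x.2,
        h.toIsPadicHomOn.map_inv (heB _), h.toIsPadicHomOn.map_padicPow hc he hb, hb1]
      ring
    refine ⟨.ofAdd (ψ x, (i ⟨_, h2⟩).toAdd), Subtype.ext ?_⟩
    change e (ψ x) * (i.symm (i ⟨_, h2⟩) : G) = x
    rw [ContinuousMulEquiv.symm_apply_apply]
    simp

/-- Homomorphisms to `ℤ_p` extend along commutative extensions by `ℤ_p`. -/
theorem IsZpFactor.exists_extend (h : IsZpFactor A B ψ) (hG : IsProP p G)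
    (hB : ∀ x ∈ B, ∀ y ∈ B, x * y = y * x) {f : G → ℤ_[p]} (hf : IsPadicHomOn A f) :
    ∃ f' : G → ℤ_[p], IsPadicHomOn B f' ∧ ∀ a ∈ A, f' a = f a := by
  have := hG.isTopologicalGroup
  obtain ⟨b, hb, hb1⟩ := h.exists_eq_one
  obtain ⟨e, hc, he, rfl⟩ := hG.exists_padicPow b
  have heB := padicPow_mem he hc h.isClosed hb
  have hmem : ∀ x ∈ B, (e (ψ x))⁻¹ * x ∈ A := by
    intro x hx
    rw [← h.eq_zero_iff _ (B.mul_mem (B.inv_mem (heB _)) hx), h.map_mul _ (B.inv_mem (heB _)) _ hx,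
      h.toIsPadicHomOn.map_inv (heB _), h.toIsPadicHomOn.map_padicPow hc he hb, hb1]
    ring
  refine ⟨fun x => f ((e (ψ x))⁻¹ * x), ⟨h.isClosed, ?_, ?_⟩, ?_⟩
  · refine hf.continuousOn.comp ?_ hmem
    exact ((hc.comp_continuousOn h.continuousOn).inv).mul continuousOn_id
  · intro x hx y hy
    rw [← hf.map_mul _ (hmem x hx) _ (hmem y hy), h.map_mul x hx y hy, he, mul_inv_rev,
      hB _ (B.inv_mem (heB _)) _ (B.inv_mem (heB _))]
    congr 1
    rw [mul_assoc, mul_assoc]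
    congr 1
    rw [← mul_assoc, ← mul_assoc, hB _ (B.inv_mem (heB _)) _ hx]
  · intro a ha
    simp [h.map_of_mem ha, padicPow_zero he]

/-- A torsion-free commutative group that contains a `ℤ_p`-lattice with quotient of finite exponent
is isomorphic to this lattice: a power map embeds it into the lattice as a submodule of full rank
over the principal ideal domain `ℤ_p`. -/
theorem HasNoTorsion.nonempty_continuousMulEquiv_of_pow_mem (htf : HasNoTorsion G)
    (hG : IsProP p G) {V K : Subgroup G}
    (hK : IsClosed (K : Set G)) (hKc : ∀ x ∈ K, ∀ y ∈ K, x * y = y * x) (hVK : V ≤ K) {n : ℕ}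
    (hn : n ≠ 0) (hKV : ∀ x ∈ K, x ^ n ∈ V)
    {E : Type*} [AddCommGroup E] [TopologicalSpace E] [IsTopologicalAddGroup E]
    [Module ℤ_[p] E] [Module.Free ℤ_[p] E]
    [Module.Finite ℤ_[p] E] [IsModuleTopology ℤ_[p] E] [CompactSpace E] [T2Space E]
    (hE : Nonempty (V ≃ₜ* Multiplicative E)) : Nonempty (K ≃ₜ* Multiplicative E) := by
  have := hG.isTopologicalGroup
  have := hG.compactSpace
  have : CompactSpace K := isCompact_iff_compactSpace.1 hK.isCompact
  have : CompactSpace (Multiplicative E) := inferInstanceAs (CompactSpace E)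
  have : T2Space (Multiplicative E) := inferInstanceAs (T2Space E)
  obtain ⟨i⟩ := hE
  let f : K →* Multiplicative E :=
    { toFun := fun x => i ⟨x ^ n, hKV x x.2⟩
      map_one' := by
        rw [map_eq_one_iff i i.injective]
        exact Subtype.ext (by simp)
      map_mul' := fun x y => by
        rw [← map_mul]
        congr 1
        exact Subtype.ext ((show Commute (x : G) y from hKc x x.2 y y.2).mul_pow n) }
  have hfc : Continuous f := i.continuous.comp
    ((continuous_subtype_val.pow n).subtype_mk _)
  have hfi : Function.Injective f := by
    rw [injective_iff_map_eq_one]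
    intro x hx
    have h1 := (map_eq_one_iff i i.injective).1 hx
    exact Subtype.ext (htf.eq_one_of_pow hn (congrArg Subtype.val h1))
  have hfcl : IsClosed (Set.range fun x => (f x).toAdd) :=
    (isCompact_range (continuous_toAdd.comp hfc)).isClosed
  let W : Submodule ℤ_[p] E :=
    { carrier := Set.range fun x => (f x).toAdd
      add_mem' := by
        rintro _ _ ⟨x, rfl⟩ ⟨y, rfl⟩
        exact ⟨x * y, by simp⟩
      zero_mem' := ⟨1, by simp⟩
      smul_mem' := by
        rintro c _ ⟨x, rfl⟩
        have hcl : IsClosed {c : ℤ_[p] | c • (f x).toAdd ∈ Set.range fun x => (f x).toAdd} := by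
          have : ContinuousSMul ℤ_[p] E := IsModuleTopology.toContinuousSMul _ _
          exact hfcl.preimage (continuous_id.smul continuous_const)
        refine PadicInt.denseRange_natCast.induction_on
          (p := fun c => c • (f x).toAdd ∈ Set.range fun x => (f x).toAdd) c hcl fun m => ?_
        exact ⟨x ^ m, by simp [Nat.cast_smul_eq_nsmul]⟩ }
  have hnW : ∀ v : E, (n : ℤ_[p]) • v ∈ W := by
    intro v
    refine ⟨⟨i.symm (.ofAdd v), hVK (SetLike.coe_mem _)⟩, ?_⟩
    have : (⟨(i.symm (.ofAdd v) : G) ^ n, hKV _ (hVK (SetLike.coe_mem _))⟩ : V) =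
      (i.symm (.ofAdd v)) ^ n := rfl
    change (i ⟨(i.symm (.ofAdd v) : G) ^ n, _⟩).toAdd = _
    rw [this, map_pow, ContinuousMulEquiv.apply_symm_apply, toAdd_pow, toAdd_ofAdd,
      Nat.cast_smul_eq_nsmul]
  have hn' : (n : ℤ_[p]) ≠ 0 := by exact_mod_cast hn
  have hrank : Module.finrank ℤ_[p] E = Module.finrank ℤ_[p] W := by
    refine le_antisymm ?_ (Submodule.finrank_le W)
    refine LinearMap.finrank_le_finrank_of_injective
      (f := (LinearMap.lsmul ℤ_[p] E (n : ℤ_[p])).codRestrict W hnW) ?_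
    exact fun x y hxy => smul_right_injective E hn' (congrArg Subtype.val hxy)
  let j : E ≃ₗ[ℤ_[p]] W := LinearEquiv.ofFinrankEq _ _ hrank
  let g : E →ₗ[ℤ_[p]] E := W.subtype ∘ₗ j.toLinearMap
  have hgc : Continuous g := IsModuleTopology.continuous_of_linearMap g
  have hgi : Function.Injective g := Subtype.val_injective.comp j.injective
  refine nonempty_continuousMulEquiv_of_range_eq (f := f)
    (g := AddMonoidHom.toMultiplicative g.toAddMonoidHom) hfc ?_ hfi ?_ ?_
  · exact continuous_ofAdd.comp (hgc.comp continuous_toAdd)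
  · exact fun x y hxy => Multiplicative.toAdd.injective (hgi (Multiplicative.ofAdd.injective hxy))
  · ext z
    constructor
    · rintro ⟨x, rfl⟩
      refine ⟨.ofAdd (j.symm ⟨(f x).toAdd, x, rfl⟩), ?_⟩
      change Multiplicative.ofAdd ((j (j.symm _) : W) : E) = _
      rw [LinearEquiv.apply_symm_apply]
      rfl
    · rintro ⟨y, rfl⟩
      obtain ⟨x, hx⟩ := (j y.toAdd).2
      exact ⟨x, Multiplicative.toAdd.injective hx⟩

end Lattices

/-! ### Construction of semidirect products -/

section Semidirect

/-- `G` is a semidirect product `(ℤ_p × ℤ_p) ⋊ ℤ_p` if `p` is odd, and it has a closed subgroup of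
index two with this property if `p = 2`. -/
def HasZpSqSemidirectType (p : ℕ) [Fact p.Prime] (G : Type*) [Group G] [TopologicalSpace G] :
    Prop :=
  (p ≠ 2 → IsZpSqSemidirectZp p G) ∧
    (p = 2 → ∃ H : Subgroup G, IsClosed (H : Set G) ∧ H.index = 2 ∧ IsZpSqSemidirectZp p H)

variable {p : ℕ} [Fact p.Prime] {G : Type*} [Group G] [TopologicalSpace G] {A B : Subgroup G}
  {φ : G → ℤ_[p]}

/-- Extensions by `ℤ_p` split, because a lift of a topological generator has `p`-adic powers. -/
theorem IsZpFactor.isZpSqSemidirectZp (h : IsZpFactor A ⊤ φ) (hG : IsProP p G)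
    (hA : Nonempty (A ≃ₜ* Multiplicative (ℤ_[p] × ℤ_[p]))) : IsZpSqSemidirectZp p G := by
  have := hG.t2Space
  obtain ⟨b, hb, hb1⟩ := h.exists_eq_one
  obtain ⟨e, hc, he, rfl⟩ := hG.exists_padicPow b
  have hφe : ∀ z, φ (e z) = z := fun z => by
    rw [h.toIsPadicHomOn.map_padicPow hc he hb, hb1, mul_one]
  let f : Multiplicative ℤ_[p] →* G :=
    { toFun := fun z => e z.toAdd
      map_one' := padicPow_zero he
      map_mul' := fun x y => he _ _ }
  have hfc : Continuous f := hc.comp continuous_toAdd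
  have hfi : Function.Injective f := fun x y hxy => Multiplicative.toAdd.injective (by
    rw [← hφe x.toAdd, ← hφe y.toAdd]
    exact congrArg φ hxy)
  have hcl : IsClosed (f.range : Set G) := (isCompact_range hfc).isClosed
  have : CompactSpace f.range := isCompact_iff_compactSpace.1 (isCompact_range hfc)
  refine ⟨A, f.range, ⟨fun a ha g => ?_⟩, h.isClosed_left, hcl, ?_, hA, ?_⟩
  · rw [← h.eq_zero_iff _ (Subgroup.mem_top _),
      h.toIsPadicHomOn.map_conj (Subgroup.mem_top _) (Subgroup.mem_top _), h.map_of_mem ha]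
  · refine Subgroup.isComplement'_of_disjoint_and_mul_eq_univ ?_ ?_
    · rw [Subgroup.disjoint_def]
      rintro _ hx ⟨z, rfl⟩
      have : φ (e z.toAdd) = 0 := h.map_of_mem hx
      rw [hφe] at this
      change e z.toAdd = 1
      rw [this, padicPow_zero he]
    · refine Set.eq_univ_of_forall fun g => ?_
      refine ⟨g * (e (φ g))⁻¹, ?_, e (φ g), ⟨.ofAdd (φ g), rfl⟩, by simp⟩
      refine (h.eq_zero_iff _ (Subgroup.mem_top _)).1 ?_
      rw [h.map_mul _ (Subgroup.mem_top _) _ (Subgroup.mem_top _),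
        h.toIsPadicHomOn.map_inv (Subgroup.mem_top _), hφe, add_neg_cancel]
  · exact nonempty_continuousMulEquiv_of_range_eq (f := f.range.subtype) (g := f)
      continuous_subtype_val hfc Subtype.val_injective hfi (Subgroup.range_subtype _)

theorem IsZpFactor.isZpSqSemidirectZp_subgroup (h : IsZpFactor A B φ) (hG : IsProP p G)
    (hA : Nonempty (A ≃ₜ* Multiplicative (ℤ_[p] × ℤ_[p]))) : IsZpSqSemidirectZp p B := by
  have := hG.compactSpace
  have := hG.t2Space
  have hAc : IsClosed (A.subgroupOf B : Set B) := h.isClosed_left.preimage continuous_subtype_val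
  have : CompactSpace B := isCompact_iff_compactSpace.1 h.isClosed.isCompact
  have : CompactSpace A := isCompact_iff_compactSpace.1 h.isClosed_left.isCompact
  have : CompactSpace (A.subgroupOf B) := isCompact_iff_compactSpace.1 hAc.isCompact
  have h' : IsZpFactor (A.subgroupOf B) ⊤ fun b : B => φ b := by
    refine ⟨⟨by simp, ?_, fun x _ y _ => h.map_mul x x.2 y y.2⟩, le_top,
      fun x _ => h.eq_zero_iff x x.2, ?_⟩
    · exact (continuousOn_iff_continuous_domRestrict.1 h.continuousOn).continuousOn
    · obtain ⟨b, hb, hb1⟩ := h.exists_eq_one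
      exact ⟨⟨b, hb⟩, Subgroup.mem_top _, hb1⟩
  refine h'.isZpSqSemidirectZp (hG.subgroup h.isClosed) ?_
  obtain ⟨i⟩ := nonempty_continuousMulEquiv_of_range_eq
    (f := B.subtype.comp (A.subgroupOf B).subtype)
    (g := A.subtype) (continuous_subtype_val.comp continuous_subtype_val) continuous_subtype_val
    (Subtype.val_injective.comp Subtype.val_injective) Subtype.val_injective (by
      rw [MonoidHom.range_comp, Subgroup.range_subtype, Subgroup.range_subtype,
        Subgroup.map_subgroupOf_eq_of_le h.le])
  exact hA.map i.trans

theorem ZMod.xor_add_one_eq_zero : ∀ z : ZMod 2, Xor (z + 1 = 0) (z = 0) := by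
  decide

/-- Subgroups of index two suffice: they do not exist for odd `p`, and if `p = 2` and the group
itself is a semidirect product, then it also contains one of index two. -/
theorem IsZpFactor.hasZpSqSemidirectType (h : IsZpFactor A B φ) (hG : IsProP p G)
    (hA : Nonempty (A ≃ₜ* Multiplicative (ℤ_[p] × ℤ_[p]))) (hB : B.index = 1 ∨ B.index = 2) :
    HasZpSqSemidirectType p G := by
  have := hG.isTopologicalGroup
  have := hG.compactSpace
  refine ⟨fun hp => ?_, fun hp => ?_⟩
  · rcases hB with hB | hB
    · rw [Subgroup.index_eq_one] at hB
      subst hB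
      exact h.isZpSqSemidirectZp hG hA
    · exfalso
      have : B.Normal := Subgroup.normal_of_index_eq_two hB
      have : B.FiniteIndex := ⟨by rw [hB]; exact two_ne_zero⟩
      have hBo := Subgroup.isOpen_of_isClosed_of_finiteIndex B h.isClosed
      obtain ⟨n, hn⟩ := IsPGroup.iff_card.1 (hG.isPGroup_quotient B hBo)
      rw [← Subgroup.index_eq_card, hB] at hn
      have := (Nat.prime_dvd_prime_iff_eq Nat.prime_two Fact.out).1
        (Nat.prime_two.dvd_of_dvd_pow (Dvd.intro_left 1 (by rw [one_mul, ← hn]) : 2 ∣ p ^ n))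
      exact hp this.symm
  · rcases hB with hB | hB
    · rw [Subgroup.index_eq_one] at hB
      subst hB
      subst hp
      have htop : ∀ x : G, x ∈ (⊤ : Subgroup G) := Subgroup.mem_top
      let H : Subgroup G :=
        { carrier := {g | (2 : ℤ_[2]) ∣ φ g}
          mul_mem' := fun {x y} hx hy => by
            change (2 : ℤ_[2]) ∣ φ (x * y)
            rw [h.map_mul x (htop x) y (htop y)]
            exact dvd_add hx hy
          one_mem' := by
            change (2 : ℤ_[2]) ∣ φ 1
            rw [h.toIsPadicHomOn.map_one]
            exact dvd_zero _
          inv_mem' := fun {x} hx => by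
            change (2 : ℤ_[2]) ∣ φ x⁻¹
            rw [h.toIsPadicHomOn.map_inv (htop x)]
            exact (dvd_neg (α := ℤ_[2])).2 hx }
      have hcl : IsClosed {z : ℤ_[2] | 2 ∣ z} := by
        have : {z : ℤ_[2] | 2 ∣ z} = Set.range fun y => 2 * y := by
          ext z
          exact ⟨fun ⟨y, hy⟩ => ⟨y, hy.symm⟩, fun ⟨y, hy⟩ => ⟨y, hy.symm⟩⟩
        rw [this]
        exact (isCompact_range (continuous_const_mul 2)).isClosed
      have hHc : IsClosed (H : Set G) := hcl.preimage (by
        simpa using h.continuousOn)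
      obtain ⟨b, hb, hb1⟩ := h.exists_eq_one
      have hb2 : φ (b ^ 2) = 2 := by
        rw [h.toIsPadicHomOn.map_pow hb, hb1]
        norm_num
      obtain ⟨ψ', hψ'⟩ := h.restrict (A' := A) (B' := H) hHc le_top (fun _ _ => Iff.rfl)
        (fun x hx => by
          change (2 : ℤ_[2]) ∣ φ x
          rw [h.map_of_mem hx]
          exact dvd_zero _)
        ⟨b ^ 2, by change (2 : ℤ_[2]) ∣ φ (b ^ 2); rw [hb2], fun hbA => by
          have := h.map_of_mem hbA
          rw [hb2] at this
          exact two_ne_zero this⟩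
      refine ⟨H, hHc, ?_, hψ'.isZpSqSemidirectZp_subgroup hG hA⟩
      rw [Subgroup.index_eq_two_iff]
      refine ⟨b, fun g => ?_⟩
      have key : ∀ x : ℤ_[2], 2 ∣ x ↔ PadicInt.toZMod x = 0 := by
        intro x
        rw [← RingHom.mem_ker, PadicInt.ker_toZMod, PadicInt.maximalIdeal_eq_span_p,
          Ideal.mem_span_singleton]
        rfl
      change Xor (2 ∣ φ (g * b)) (2 ∣ φ g)
      rw [h.map_mul g (htop g) b hb, hb1, key, key, map_add, map_one]
      exact ZMod.xor_add_one_eq_zero _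
    · exact ⟨B, h.isClosed, hB, h.isZpSqSemidirectZp_subgroup hG hA⟩

/-- If `ker φ / A` has at most two elements, then `A` and a lift of a generator of `ℤ_p` generate a
semidirect product of index at most two. -/
theorem IsPadicHomOn.hasZpSqSemidirectType (hφ : IsPadicHomOn ⊤ φ) (hG : IsProP p G)
    (ht : ∃ t, φ t = 1) (hAn : A.Normal) (hAc : IsClosed (A : Set G)) (hAφ : ∀ a ∈ A, φ a = 0)
    (hmul : ∀ a b, φ a = 0 → φ b = 0 → a ∉ A → b ∉ A → a * b ∈ A)
    (hA : Nonempty (A ≃ₜ* Multiplicative (ℤ_[p] × ℤ_[p]))) : HasZpSqSemidirectType p G := by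
  have := hG.isTopologicalGroup
  have htop : ∀ x : G, x ∈ (⊤ : Subgroup G) := Subgroup.mem_top
  have hφc : Continuous φ := by simpa using hφ.continuousOn
  obtain ⟨t, ht⟩ := ht
  obtain ⟨e, hc, he, rfl⟩ := hG.exists_padicPow t
  have hφe : ∀ z, φ (e z) = z := fun z => by
    rw [hφ.map_padicPow hc he (htop _), ht, mul_one]
  have hker : ∀ g, φ (g * (e (φ g))⁻¹) = 0 := fun g => by
    rw [hφ.map_mul _ (htop _) _ (htop _), hφ.map_inv (htop _), hφe, add_neg_cancel]
  let H : Subgroup G :=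
    { carrier := {g | g * (e (φ g))⁻¹ ∈ A}
      mul_mem' := fun {x y} hx hy => by
        have : x * y * (e (φ (x * y)))⁻¹ = (x * (y * (e (φ y))⁻¹) * x⁻¹) * (x * (e (φ x))⁻¹) := by
          rw [hφ.map_mul _ (htop _) _ (htop _), he]
          group
        change _ ∈ A
        rw [this]
        exact A.mul_mem (hAn.conj_mem _ hy _) hx
      one_mem' := by
        change _ ∈ A
        rw [hφ.map_one, padicPow_zero he]
        simp [A.one_mem]
      inv_mem' := fun {x} hx => by
        have : x⁻¹ * (e (φ x⁻¹))⁻¹ = x⁻¹ * (x * (e (φ x))⁻¹)⁻¹ * x⁻¹⁻¹ := by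
          rw [hφ.map_inv (htop _), padicPow_neg he]
          group
        change _ ∈ A
        rw [this]
        exact hAn.conj_mem _ (A.inv_mem hx) _ }
  have hHmem : ∀ g, g ∈ H ↔ g * (e (φ g))⁻¹ ∈ A := fun g => Iff.rfl
  have hHmem0 : ∀ g, φ g = 0 → (g ∈ H ↔ g ∈ A) := fun g hg => by
    rw [hHmem, hg, padicPow_zero he, inv_one, mul_one]
  have hHc : IsClosed (H : Set G) := hAc.preimage
    (f := fun g => g * (e (φ g))⁻¹) (continuous_id.mul (hc.comp hφc).inv)
  have hfac : IsZpFactor A H φ := by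
    refine ⟨hφ.mono le_top hHc, fun a ha => (hHmem0 a (hAφ a ha)).2 ha, fun x hx => ?_,
      e 1, ?_, ht⟩
    · exact ⟨fun h0 => (hHmem0 x h0).1 hx, hAφ x⟩
    · rw [hHmem, ht, mul_inv_cancel]
      exact A.one_mem
  refine hfac.hasZpSqSemidirectType hG hA ?_
  by_cases hk : ∃ k, φ k = 0 ∧ k ∉ A
  · right
    obtain ⟨k, hk0, hkA⟩ := hk
    rw [Subgroup.index_eq_two_iff]
    refine ⟨k, fun b => ?_⟩
    have h1 : φ (b * k) = φ b := by rw [hφ.map_mul _ (htop _) _ (htop _), hk0, add_zero]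
    have h2 : b * k * (e (φ b))⁻¹ = (b * k * b⁻¹) * (b * (e (φ b))⁻¹) := by group
    have h3 : φ (b * k * b⁻¹) = 0 := by rw [hφ.map_conj (htop _) (htop _), hk0]
    have h4 : b * k * b⁻¹ ∉ A := by rwa [hAn.mem_comm_iff, ← mul_assoc, inv_mul_cancel, one_mul]
    rw [hHmem, hHmem, h1, h2]
    by_cases h5 : b * (e (φ b))⁻¹ ∈ A
    · exact Or.inr ⟨h5, fun h6 => h4 ((A.mul_mem_cancel_right h5).1 h6)⟩
    · exact Or.inl ⟨hmul _ _ h3 (hker b) h4 h5, h5⟩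
  · left
    push Not at hk
    rw [Subgroup.index_eq_one, eq_top_iff]
    exact fun g _ => hk _ (hker g)

end Semidirect

/-! ### Kernels of dimension two -/

section Kernel

variable {p : ℕ} [Fact p.Prime] {G : Type*} [Group G] [TopologicalSpace G]
  {N V : Subgroup G} {φ ψ ψ₁ : G → ℤ_[p]}

/-- On a normal subgroup isomorphic to `ℤ_p`, acting trivially means commuting. -/
theorem IsZpFactor.commute_of_bot (h : IsZpFactor ⊥ N ψ) (hN : N.Normal) {g x : G}
    (hx : x ∈ N) (hg : ψ (g * x * g⁻¹) = ψ x) : g * x = x * g := by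
  have h1 := hN.conj_mem x hx g
  have h2 : g * x * g⁻¹ * x⁻¹ ∈ (⊥ : Subgroup G) := by
    rw [← h.eq_zero_iff _ (N.mul_mem h1 (N.inv_mem hx)), h.map_mul _ h1 _ (N.inv_mem hx),
      h.toIsPadicHomOn.map_inv hx, hg, add_neg_cancel]
  rw [Subgroup.mem_bot, mul_inv_eq_one, mul_inv_eq_iff_eq_mul] at h2
  exact h2

/-- A subgroup acts trivially on its own `ℤ_p`-factors. -/
theorem IsZpFactor.character_eq_one (h : IsZpFactor N V ψ) {χ : G →* ℤ_[p]}
    (hχ : ∀ g, ∀ b ∈ V, ψ (g * b * g⁻¹) = χ g * ψ b) {v : G} (hv : v ∈ V) : χ v = 1 := by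
  obtain ⟨b, hb, hb1⟩ := h.exists_eq_one
  have := hχ v b hb
  rwa [h.toIsPadicHomOn.map_conj hv hb, hb1, mul_one, eq_comm] at this

/-- An element that acts as `-1` on a factor and commutes with `v` has `v` in the kernel. -/
theorem IsZpFactor.mem_of_character_eq_neg_one (h : IsZpFactor N V ψ) {χ : G →* ℤ_[p]}
    (hχ : ∀ g, ∀ b ∈ V, ψ (g * b * g⁻¹) = χ g * ψ b) {g v : G} (hg : χ g = -1) (hv : v ∈ V)
    (hgv : g * v = v * g) : v ∈ N := by
  have h1 := hχ g v hv
  rw [hgv, mul_inv_cancel_right, hg, neg_one_mul, eq_neg_iff_add_eq_zero, ← two_mul,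
    mul_eq_zero, or_iff_right two_ne_zero] at h1
  exact (h.eq_zero_iff v hv).1 h1

theorem PadicInt.eq_one_or_neg_one_of_sq {x : ℤ_[p]} (h : x ^ 2 = 1) : x = 1 ∨ x = -1 :=
  mul_self_eq_one_iff.1 ((pow_two x).symm.trans h)

/-- Let `φ` map onto `ℤ_p` with a kernel `K` that is virtually an extension `V` of `ℤ_p` by
`N ≅ ℤ_p`. The elements of `K` act on `N` and `V / N` by signs, and not both signs can be `-1`,
as some power of such an element would be inverted and fixed by it. Hence the elements of `K` that
act trivially form a subgroup `A` of index at most two, and `A` is commutative by unipotence. -/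
theorem hasZpSqSemidirectType_of_kernel (hφ : IsPadicHomOn ⊤ φ) (hG : IsProP p G)
    (htf : HasNoTorsion G) (ht : ∃ t, φ t = 1) (hN : N.Normal) (hV : V.Normal)
    (h₁ : IsZpFactor ⊥ N ψ₁) (h : IsZpFactor N V ψ) (hVφ : ∀ v ∈ V, φ v = 0)
    {U : Subgroup G} (hUn : U.Normal) (hU : IsOpen (U : Set G)) (hUV : ∀ u ∈ U, φ u = 0 → u ∈ V)
    {χ₁ : G →* ℤ_[p]} (hχ₁c : Continuous χ₁)
    (hχ₁ : ∀ g, ∀ b ∈ N, ψ₁ (g * b * g⁻¹) = χ₁ g * ψ₁ b)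
    (hχ₁K : ∀ k, φ k = 0 → χ₁ k ^ 2 = 1) : HasZpSqSemidirectType p G := by
  have := hG.isTopologicalGroup
  have := hG.compactSpace
  have := hG.t2Space
  have htop : ∀ x : G, x ∈ (⊤ : Subgroup G) := Subgroup.mem_top
  have hφc : Continuous φ := by simpa using hφ.continuousOn
  have hφmul : ∀ x y, φ (x * y) = φ x + φ y := fun x y => hφ.map_mul x (htop x) y (htop y)
  have hUf : Finite (G ⧸ U) := U.quotient_finite_of_isOpen hU
  have hUfi : U.FiniteIndex := U.finiteIndex_of_finite_quotient
  obtain ⟨n, hn, hnV⟩ : ∃ n : ℕ, n ≠ 0 ∧ ∀ k, φ k = 0 → k ^ n ∈ V := by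
    refine ⟨U.index, hUfi.index_ne_zero, fun k hk => hUV _ (U.pow_index_mem k) ?_⟩
    rw [hφ.map_pow (htop k), hk, mul_zero]
  obtain ⟨χ, hχc, hχ⟩ := h.exists_character hG hN hV
  have hχK : ∀ k, φ k = 0 → χ k ^ 2 = 1 := fun k hk =>
    hG.character_sq_eq_one_of_pow hχc hn
      (by rw [← map_pow]; exact h.character_eq_one hχ (hnV k hk))
  have hneg : ∀ k, φ k = 0 → χ₁ k = -1 → χ k = -1 → False := by
    intro k hk h1 h2
    have hcomm : k * k ^ n = k ^ n * k := ((Commute.refl k).pow_right n)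
    have h3 := h.mem_of_character_eq_neg_one hχ h2 (hnV k hk) hcomm
    have h4 := h₁.mem_of_character_eq_neg_one hχ₁ h1 h3 hcomm
    rw [Subgroup.mem_bot] at h4
    rw [htf.eq_one_of_pow hn h4, map_one] at h2
    norm_num [← sub_eq_zero] at h2
  let A : Subgroup G :=
    { carrier := {g | φ g = 0 ∧ χ₁ g = 1 ∧ χ g = 1}
      mul_mem' := fun {x y} hx hy => ⟨by rw [hφmul, hx.1, hy.1, add_zero],
        by rw [map_mul, hx.2.1, hy.2.1, one_mul], by rw [map_mul, hx.2.2, hy.2.2, one_mul]⟩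
      one_mem' := ⟨hφ.map_one, map_one _, map_one _⟩
      inv_mem' := fun {x} hx => by
        have h1 : χ₁ x * χ₁ x⁻¹ = 1 := by rw [← map_mul, mul_inv_cancel, map_one]
        have h2 : χ x * χ x⁻¹ = 1 := by rw [← map_mul, mul_inv_cancel, map_one]
        rw [hx.2.1, one_mul] at h1
        rw [hx.2.2, one_mul] at h2
        exact ⟨by rw [hφ.map_inv (htop x), hx.1, neg_zero], h1, h2⟩ }
  have hAmem : ∀ g, g ∈ A ↔ φ g = 0 ∧ χ₁ g = 1 ∧ χ g = 1 := fun g => Iff.rfl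
  have hconj : ∀ (ξ : G →* ℤ_[p]) (g x : G), ξ (g * x * g⁻¹) = ξ x := fun ξ g x => by
    have : ξ g * ξ g⁻¹ = 1 := by rw [← map_mul, mul_inv_cancel, map_one]
    rw [map_mul, map_mul]
    linear_combination ξ x * this
  have hAn : A.Normal := ⟨fun a ha g => by
    rw [hAmem, hφ.map_conj (htop g) (htop a), hconj, hconj]
    exact ha⟩
  have hAc : IsClosed (A : Set G) :=
    (isClosed_eq hφc continuous_const).inter
      ((isClosed_eq hχ₁c continuous_const).inter (isClosed_eq hχc continuous_const))
  have hAVc : IsClosed ((A ⊓ V : Subgroup G) : Set G) := hAc.inter h.isClosed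
  have hNA : N ≤ A := fun x hx => ⟨hVφ x (h.le hx), h₁.character_eq_one hχ₁ hx,
    h.character_eq_one hχ (h.le hx)⟩
  obtain ⟨b, hb, hb1⟩ := h.exists_eq_one
  obtain ⟨ψ', hψ'⟩ := h.restrict (A' := N) hAVc inf_le_right (fun _ _ => Iff.rfl)
    (le_inf hNA h.le) ⟨b ^ 2, ⟨⟨by rw [hφ.map_pow (htop b), hVφ b hb, mul_zero],
      by rw [map_pow, hχ₁K b (hVφ b hb)], by rw [map_pow, hχK b (hVφ b hb)]⟩, V.pow_mem hb 2⟩,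
      fun hbN => by
        have := h.map_of_mem hbN
        rw [h.toIsPadicHomOn.map_pow hb, hb1] at this
        norm_num at this⟩
  have hNcomm : ∀ a ∈ A, ∀ x ∈ N, a * x = x * a := fun a ha x hx =>
    h₁.commute_of_bot hN hx (by rw [hχ₁ a x hx, ha.2.1, one_mul])
  have hAVcomm : ∀ x ∈ A ⊓ V, ∀ y ∈ A ⊓ V, x * y = y * x :=
    hψ'.commute_of_central hG fun a ha b hb => (hNcomm b hb.1 a ha).symm
  have hAV : ∀ a ∈ A, ∀ x ∈ A ⊓ V, a * x = x * a := by
    intro a ha x hx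
    refine h.commute_of_pow htf hV (hNcomm a ha) (fun b hb => ?_) hn hx.2 ?_
    · rw [hχ a b hb, ha.2.2, one_mul]
    · exact hAVcomm _ ⟨A.pow_mem ha n, hnV a ha.1⟩ _ hx
  have hAcomm : ∀ x ∈ A, ∀ y ∈ A, x * y = y * x := by
    refine htf.commute_of_relIndex_ne_zero (V := A ⊓ U) ?_ fun v hv a ha => ?_
    · rw [Subgroup.inf_relIndex_left]
      exact ne_zero_of_dvd_ne_zero hUfi.index_ne_zero (Subgroup.relIndex_dvd_index_of_normal U A)
    · exact (hAV a ha v ⟨hv.1, hUV v hv.2 hv.1.1⟩).symm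
  have hAiso : Nonempty (A ≃ₜ* Multiplicative (ℤ_[p] × ℤ_[p])) :=
    htf.nonempty_continuousMulEquiv_of_pow_mem hG hAc hAcomm inf_le_left hn
      (fun a ha => ⟨A.pow_mem ha n, hnV a ha.1⟩)
      (hψ'.nonempty_continuousMulEquiv_prod hG hAVcomm (h₁.nonempty_continuousMulEquiv_of_bot hG))
  refine hφ.hasZpSqSemidirectType hG ht hAn hAc (fun a ha => ha.1) ?_ hAiso
  intro x y hx hy hxA hyA
  refine ⟨by rw [hφmul, hx, hy, add_zero], ?_⟩
  rw [map_mul, map_mul]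
  rw [hAmem, not_and] at hxA hyA
  have hxA := hxA hx
  have hyA := hyA hy
  rcases PadicInt.eq_one_or_neg_one_of_sq (hχ₁K x hx) with h1 | h1 <;>
  rcases PadicInt.eq_one_or_neg_one_of_sq (hχK x hx) with h2 | h2 <;>
  rcases PadicInt.eq_one_or_neg_one_of_sq (hχ₁K y hy) with h3 | h3 <;>
  rcases PadicInt.eq_one_or_neg_one_of_sq (hχK y hy) with h4 | h4 <;>
  first
  | exact (hxA ⟨h1, h2⟩).elim
  | exact (hyA ⟨h3, h4⟩).elim
  | exact (hneg x hx h1 h2).elim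
  | exact (hneg y hy h3 h4).elim
  | rw [h1, h2, h3, h4, neg_one_mul, neg_neg, one_mul]; exact ⟨rfl, rfl⟩
  | exact (hneg (x * y) (by rw [hφmul, hx, hy, add_zero]) (by rw [map_mul, h1, h3]; norm_num)
      (by rw [map_mul, h2, h4]; norm_num)).elim

end Kernel

/-! ### Chains with factors `ℤ_p` in polycyclic groups -/

section Chain

theorem IsProP.index_ne_zero_of_isOpen {p : ℕ} {G : Type*} [Group G]
    [TopologicalSpace G] (hG : IsProP p G) {U : Subgroup G}
    (hU : IsOpen (U : Set G)) : U.index ≠ 0 := by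
  have := hG.isTopologicalGroup
  have := hG.compactSpace
  have := U.quotient_finite_of_isOpen hU
  exact U.finiteIndex_of_finite_quotient.index_ne_zero

variable {p : ℕ} [Fact p.Prime] {G : Type*} [Group G] [TopologicalSpace G]

/-- A chain `1 ≤ U₁ ≤ U₂ ≤ U₃` of closed normal subgroups of `G` with `U₃` open and all three
factors isomorphic to `ℤ_p`. -/
structure IsZpChain (p : ℕ) [Fact p.Prime] {G : Type*} [Group G] [TopologicalSpace G]
    (U₁ U₂ U₃ : Subgroup G) : Prop where
  normal₁ : U₁.Normal
  normal₂ : U₂.Normal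
  normal₃ : U₃.Normal
  isOpen : IsOpen (U₃ : Set G)
  factor₁ : ∃ ψ : G → ℤ_[p], IsZpFactor ⊥ U₁ ψ
  factor₂ : ∃ ψ : G → ℤ_[p], IsZpFactor U₁ U₂ ψ
  factor₃ : ∃ ψ : G → ℤ_[p], IsZpFactor U₂ U₃ ψ

/-- Intersecting with an open normal subgroup preserves `ℤ_p`-factors. -/
theorem IsZpFactor.inf_isOpen {A B : Subgroup G} {ψ : G → ℤ_[p]} (h : IsZpFactor A B ψ)
    (hG : IsProP p G) {O : Subgroup G} (hOn : O.Normal) (hO : IsOpen (O : Set G)) :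
    ∃ ψ' : G → ℤ_[p], IsZpFactor (A ⊓ O) (B ⊓ O) ψ' := by
  have := hG.isTopologicalGroup
  have := hG.compactSpace
  obtain ⟨b, hb, hb1⟩ := h.exists_eq_one
  refine h.restrict (h.isClosed.inter (Subgroup.isClosed_of_isOpen O hO)) inf_le_left
    (fun x hx => ⟨fun hxA => hxA.1, fun hxA => ⟨hxA, hx.2⟩⟩) (inf_le_inf_right O h.le)
    ⟨b ^ O.index, ⟨B.pow_mem hb _, O.pow_index_mem b⟩, fun hbA => ?_⟩
  have := h.map_of_mem hbA
  rw [h.toIsPadicHomOn.map_pow hb, hb1, mul_one] at this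
  exact hG.index_ne_zero_of_isOpen hO (by exact_mod_cast this)

theorem IsZpChain.inf_isOpen {U₁ U₂ U₃ : Subgroup G} (h : IsZpChain p U₁ U₂ U₃)
    (hG : IsProP p G) {O : Subgroup G} (hOn : O.Normal) (hO : IsOpen (O : Set G)) :
    IsZpChain p (U₁ ⊓ O) (U₂ ⊓ O) (U₃ ⊓ O) := by
  have := h.normal₁
  have := h.normal₂
  have := h.normal₃
  refine ⟨inferInstance, inferInstance, inferInstance, h.isOpen.inter hO, ?_, ?_, ?_⟩
  · obtain ⟨ψ, hψ⟩ := h.factor₁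
    simpa using hψ.inf_isOpen hG hOn hO
  · obtain ⟨ψ, hψ⟩ := h.factor₂
    exact hψ.inf_isOpen hG hOn hO
  · obtain ⟨ψ, hψ⟩ := h.factor₃
    exact hψ.inf_isOpen hG hOn hO

theorem PolycyclicSeries.exists_isZpFactor (s : PolycyclicSeries G) (i : Fin s.length)
    (hc : IsClosed (s.term i.succ : Set G)) (hi : Nonempty (s.Factor i ≃ₜ* Multiplicative ℤ_[p])) :
    ∃ ψ : G → ℤ_[p], IsZpFactor (s.term i.castSucc) (s.term i.succ) ψ := by
  classical
  obtain ⟨j⟩ := hi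
  let q : s.term i.succ → s.Factor i := QuotientGroup.mk
  refine ⟨fun g => if hg : g ∈ s.term i.succ then (j (q ⟨g, hg⟩)).toAdd else 0,
    ⟨hc, ?_, ?_⟩, s.le_succ i, ?_, ?_⟩
  · rw [continuousOn_iff_continuous_domRestrict]
    have : Continuous fun g => (j (q g)).toAdd :=
      continuous_toAdd.comp (j.continuous.comp QuotientGroup.continuous_mk)
    refine this.congr fun g => ?_
    have hg : (g : G) ∈ s.term i.succ := g.2
    simp [Set.domRestrict, hg]
  · intro x hx y hy
    have hxy := (s.term i.succ).mul_mem hx hy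
    have : q ⟨x * y, hxy⟩ = q ⟨x, hx⟩ * q ⟨y, hy⟩ := rfl
    simp only [hx, hy, hxy, dif_pos, this, map_mul, toAdd_mul]
  · intro x hx
    simp only [hx, dif_pos]
    rw [toAdd_eq_zero, map_eq_one_iff j j.injective]
    exact (QuotientGroup.eq_one_iff _).trans Subgroup.mem_subgroupOf
  · obtain ⟨⟨b, hb⟩, hb1⟩ := QuotientGroup.mk_surjective (j.symm (.ofAdd 1))
    refine ⟨b, hb, ?_⟩
    simp only [hb, dif_pos]
    change (j (QuotientGroup.mk ⟨b, hb⟩)).toAdd = 1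
    rw [hb1, ContinuousMulEquiv.apply_symm_apply, toAdd_ofAdd]

/-- A procyclic factor that is not isomorphic to `ℤ_p` is finite, so it disappears after
intersecting with a small open normal subgroup. -/
theorem PolycyclicSeries.exists_isOpen_inf_le (s : PolycyclicSeries G) (hG : IsProP p G)
    (i : Fin s.length) (hi : ¬ Nonempty (s.Factor i ≃ₜ* Multiplicative ℤ_[p])) :
    ∃ O : Subgroup G, O.Normal ∧ IsOpen (O : Set G) ∧ s.term i.succ ⊓ O ≤ s.term i.castSucc := by
  have := hG.isTopologicalGroup
  have := hG.compactSpace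
  have := hG.t2Space
  let S := s.term i.succ
  let R := (s.term i.castSucc).subgroupOf S
  have hSc : IsClosed (S : Set G) := s.isClosed _
  have hRc : IsClosed (R : Set S) := (s.isClosed _).preimage continuous_subtype_val
  have : CompactSpace S := isCompact_iff_compactSpace.1 hSc.isCompact
  have : T2Space (S ⧸ R) := inferInstance
  obtain ⟨q, hq⟩ := s.cyclic_factor i
  obtain ⟨⟨g, hg⟩, rfl⟩ := QuotientGroup.mk_surjective q
  obtain ⟨e, hec, he, rfl⟩ := hG.exists_padicPow g
  have heS : ∀ z, e z ∈ S := padicPow_mem he hec hSc hg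
  let f : Multiplicative ℤ_[p] →* S ⧸ R :=
    { toFun := fun z => QuotientGroup.mk ⟨e z.toAdd, heS _⟩
      map_one' := by
        rw [QuotientGroup.eq_one_iff]
        change e 0 ∈ s.term i.castSucc
        rw [padicPow_zero he]
        exact Subgroup.one_mem _
      map_mul' := fun x y => by
        rw [← QuotientGroup.mk_mul]
        congr 1
        exact Subtype.ext (he _ _) }
  have hfc : Continuous f := QuotientGroup.continuous_mk.comp
    ((hec.comp continuous_toAdd).subtype_mk _)
  have hfs : f.range = ⊤ := by
    have hcl : IsClosed (f.range : Set (S ⧸ R)) := (isCompact_range hfc).isClosed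
    rw [eq_top_iff]
    intro x _
    refine closure_minimal ?_ hcl (hq x)
    rw [SetLike.coe_subset_coe, Subgroup.zpowers_le]
    exact ⟨.ofAdd 1, rfl⟩
  have hfin : Finite (S ⧸ R) := by
    by_contra hfin
    refine hi ((nonempty_continuousMulEquiv_of_range_eq (f := f) (g := MonoidHom.id _) hfc
      continuous_id ?_ Function.injective_id (by
        rw [hfs, MonoidHom.range_eq_top.2 Function.surjective_id])).map ContinuousMulEquiv.symm)
    rw [injective_iff_map_eq_one]
    intro z hz
    by_contra hz0
    have hz0' : z.toAdd ≠ 0 := fun h => hz0 (toAdd_eq_zero.1 h)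
    have hzR : e z.toAdd ∈ s.term i.castSucc :=
      Subgroup.mem_subgroupOf.1 ((QuotientGroup.eq_one_iff _).1 hz)
    -- a unit multiple of a nonzero `p`-adic integer is a power of `p`
    have hpow : e (((PadicInt.unitCoeff hz0')⁻¹ : ℤ_[p]ˣ) * z.toAdd) ∈ s.term i.castSucc :=
      padicPow_mem (e := fun y => e (y * z.toAdd)) (fun x y => by rw [add_mul, he])
        (hec.comp (continuous_mul_const _)) (s.isClosed _) (by rwa [one_mul]) _
    nth_rw 2 [PadicInt.unitCoeff_spec hz0'] at hpow
    rw [Units.inv_mul_cancel_left, ← Nat.cast_pow, padicPow_natCast he] at hpow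
    have hfo : IsOfFinOrder (QuotientGroup.mk ⟨e 1, hg⟩ : S ⧸ R) := by
      refine isOfFinOrder_iff_pow_eq_one.2 ⟨p ^ z.toAdd.valuation,
        pow_pos (Fact.out : p.Prime).pos _, ?_⟩
      rw [← QuotientGroup.mk_pow]
      exact (QuotientGroup.eq_one_iff _).2 (Subgroup.mem_subgroupOf.2 hpow)
    have hz : (Subgroup.zpowers (QuotientGroup.mk ⟨e 1, hg⟩ : S ⧸ R) : Set (S ⧸ R)).Finite :=
      hfo.finite_zpowers
    have huniv : (Set.univ : Set (S ⧸ R)).Finite := by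
      rwa [← hq.closure_eq, hz.isClosed.closure_eq]
    exact hfin (Set.finite_univ_iff.1 huniv)
  have hRfi : R.FiniteIndex := R.finiteIndex_of_finite_quotient
  obtain ⟨W, hW, hWR⟩ := isOpen_induced_iff.1 (R.isOpen_of_isClosed_of_finiteIndex hRc)
  have h1W : (1 : G) ∈ W := by
    have : (1 : S) ∈ Subtype.val ⁻¹' W := by
      rw [hWR]
      exact R.one_mem
    exact this
  obtain ⟨O, hOn, hO, hOW⟩ := hG.exists_openNormalSubgroup_subset (hW.mem_nhds h1W)
  refine ⟨O, hOn, hO, fun x hx => ?_⟩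
  have : (⟨x, hx.1⟩ : S) ∈ Subtype.val ⁻¹' W := hOW hx.2
  rw [hWR] at this
  exact this

theorem Set.exists_lt_lt_of_ncard_eq_three {α : Type*} [LinearOrder α] {s : Set α}
    (h : s.ncard = 3) : ∃ a b c, a < b ∧ b < c ∧ s = {a, b, c} := by
  obtain ⟨x, y, z, hxy, hxz, hyz, rfl⟩ := Set.ncard_eq_three.1 h
  rcases lt_or_gt_of_ne hxy with h1 | h1 <;> rcases lt_or_gt_of_ne hxz with h2 | h2 <;>
    rcases lt_or_gt_of_ne hyz with h3 | h3
  · exact ⟨x, y, z, h1, h3, rfl⟩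
  · exact ⟨x, z, y, h2, h3, by grind⟩
  · exact absurd (h1.trans h3) h2.not_gt
  · exact ⟨z, x, y, h2, h1, by grind⟩
  · exact ⟨y, x, z, h1, h2, by grind⟩
  · exact absurd (h3.trans h1) h2.not_gt
  · exact ⟨y, z, x, h3, h2, by grind⟩
  · exact ⟨z, y, x, h3, h1, by grind⟩

/-- A polycyclic pro-`p` group of Hirsch length three has an open normal subgroup that is
polycyclic without finite factors, by means of normal subgroups of the whole group. -/
theorem IsPolycyclicOfHirschLength.exists_isZpChain (hG : IsProP p G)
    (h : IsPolycyclicOfHirschLength p G 3) : ∃ U₁ U₂ U₃ : Subgroup G, IsZpChain p U₁ U₂ U₃ := by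
  classical
  obtain ⟨s, hs⟩ := h
  let Z : Set (Fin s.length) := {i | Nonempty (s.Factor i ≃ₜ* Multiplicative ℤ_[p])}
  obtain ⟨a, b, c, hab, hbc, hZ⟩ := Set.exists_lt_lt_of_ncard_eq_three (s := Z) hs
  have hO : ∀ i : Fin s.length, ∃ O : Subgroup G, O.Normal ∧ IsOpen (O : Set G) ∧
      (i ∉ Z → s.term i.succ ⊓ O ≤ s.term i.castSucc) := by
    intro i
    by_cases hi : i ∈ Z
    · exact ⟨⊤, inferInstance, isOpen_univ, fun h => absurd hi h⟩
    · obtain ⟨O, h1, h2, h3⟩ := s.exists_isOpen_inf_le hG i hi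
      exact ⟨O, h1, h2, fun _ => h3⟩
  choose O' hOn' hO' hOle' using hO
  let O : Subgroup G := ⨅ i, O' i
  have hOn : O.Normal := Subgroup.normal_iInf_normal hOn'
  have hO : IsOpen (O : Set G) := by
    rw [Subgroup.coe_iInf]
    exact isOpen_iInter_of_finite hO'
  -- the intersected series changes exactly at the indices `a < b < c`
  let W : ℕ → Subgroup G := fun m => if hm : m < s.length + 1 then s.term ⟨m, hm⟩ ⊓ O else O
  have hWcast : ∀ i : Fin s.length, W i = s.term i.castSucc ⊓ O := fun i => by
    have : (i : ℕ) < s.length + 1 := by omega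
    simp only [W, this, dif_pos]
    rfl
  have hWsucc : ∀ i : Fin s.length, W (i + 1) = s.term i.succ ⊓ O := fun i => by
    have : (i : ℕ) + 1 < s.length + 1 := by omega
    simp only [W, this, dif_pos]
    rfl
  have hW0 : W 0 = ⊥ := by
    have : s.term ⟨0, Nat.succ_pos _⟩ = ⊥ := s.term_zero
    simp only [W, Nat.succ_pos, dif_pos]
    rw [this, bot_inf_eq]
  have hWlast : W s.length = O := by
    have : s.term ⟨s.length, Nat.lt_succ_self _⟩ = ⊤ := s.term_last
    simp [W, this]
  have hWstep : ∀ i : Fin s.length, i ∉ Z → W (i + 1) = W i := by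
    intro i hi
    rw [hWcast, hWsucc]
    refine le_antisymm (le_inf ?_ inf_le_right) (inf_le_inf_right O (s.le_succ i))
    exact (inf_le_inf_left _ (iInf_le O' i)).trans (hOle' i hi)
  have hWconst : ∀ j k : ℕ, j ≤ k → k ≤ s.length →
      (∀ i : Fin s.length, j ≤ i → i < k → i ∉ Z) → W k = W j := by
    intro j k hjk
    induction k, hjk using Nat.le_induction with
    | base => intros; rfl
    | succ k hjk ih =>
      intro hk hZ'
      rw [hWstep ⟨k, hk⟩ (hZ' _ hjk (Nat.lt_succ_self k)), ih (by omega)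
        fun i hi hik => hZ' i hi (by omega)]
  have hWfac : ∀ i ∈ Z, ∃ ψ : G → ℤ_[p], IsZpFactor (W i) (W (i + 1)) ψ := by
    intro i hi
    obtain ⟨ψ, hψ⟩ := s.exists_isZpFactor i (s.isClosed _) hi
    rw [hWcast, hWsucc]
    exact hψ.inf_isOpen hG hOn hO
  have hWn : ∀ i : Fin s.length, (W (i + 1)).Normal := fun i => by
    rw [hWsucc]
    infer_instance
  have hmem : ∀ i, i ∈ Z ↔ i = a ∨ i = b ∨ i = c := fun i => by rw [hZ]; simp
  have hA : W a = ⊥ := by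
    rw [hWconst 0 a (Nat.zero_le _) a.2.le fun i _ hi => by rw [hmem]; omega, hW0]
  have hB : W b = W (a + 1) :=
    hWconst _ _ (by omega) b.2.le fun i h1 h2 => by rw [hmem]; omega
  have hC : W c = W (b + 1) :=
    hWconst _ _ (by omega) c.2.le fun i h1 h2 => by rw [hmem]; omega
  have hL : O = W (c + 1) := by
    rw [← hWlast]
    exact hWconst _ _ (by omega) le_rfl fun i h1 h2 => by rw [hmem]; omega
  refine ⟨W (a + 1), W (b + 1), W (c + 1), hWn a, hWn b, hWn c, hL ▸ hO, ?_, ?_, ?_⟩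
  · rw [← hA]
    exact hWfac a ((hmem a).2 (by simp))
  · rw [← hB]
    exact hWfac b ((hmem b).2 (by simp))
  · rw [← hC]
    exact hWfac c ((hmem c).2 (by simp))

end Chain

/-! ### Characters with values `1` and `-1` -/

section Signs

variable {p : ℕ} [Fact p.Prime] {G : Type*} [Group G]

theorem PadicInt.neg_one_ne_one : (-1 : ℤ_[p]) ≠ 1 := by
  intro h
  norm_num [← sub_eq_zero] at h

theorem index_ker_of_sq_eq_one {s : G →* ℤ_[p]} (hs : ∀ g, s g ^ 2 = 1) :
    s.ker.index = 1 ∨ s.ker.index = 2 := by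
  by_cases h : ∀ g, s g = 1
  · left
    rw [Subgroup.index_eq_one, eq_top_iff]
    exact fun g _ => h g
  · right
    push Not at h
    obtain ⟨a, ha⟩ := h
    have ha' := (PadicInt.eq_one_or_neg_one_of_sq (hs a)).resolve_left ha
    rw [Subgroup.index_eq_two_iff]
    refine ⟨a, fun b => ?_⟩
    rw [MonoidHom.mem_ker, MonoidHom.mem_ker, map_mul, ha']
    rcases PadicInt.eq_one_or_neg_one_of_sq (hs b) with hb | hb
    · rw [hb, one_mul]
      exact Or.inr ⟨rfl, PadicInt.neg_one_ne_one⟩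
    · rw [hb, neg_mul_neg, one_mul]
      exact Or.inl ⟨rfl, PadicInt.neg_one_ne_one⟩

theorem isOpen_ker_of_sq_eq_one [TopologicalSpace G] {s : G →* ℤ_[p]} (hsc : Continuous s)
    (hs : ∀ g, s g ^ 2 = 1) : IsOpen (s.ker : Set G) := by
  have : (s.ker : Set G) = s ⁻¹' {-1}ᶜ := by
    ext g
    simp only [SetLike.mem_coe, MonoidHom.mem_ker, Set.mem_preimage, Set.mem_compl_iff,
      Set.mem_singleton_iff]
    refine ⟨fun h h' => PadicInt.neg_one_ne_one (h'.symm.trans h),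
      (PadicInt.eq_one_or_neg_one_of_sq (hs g)).resolve_right⟩
  rw [this]
  exact isOpen_compl_singleton.preimage hsc

variable [TopologicalSpace G] {A B : Subgroup G} {ψ : G → ℤ_[p]}

theorem IsZpFactor.character_eq_one_of_commute (h : IsZpFactor A B ψ) {χ : G →* ℤ_[p]}
    (hχ : ∀ g, ∀ b ∈ B, ψ (g * b * g⁻¹) = χ g * ψ b) {g : G} (hg : ∀ b ∈ B, g * b = b * g) :
    χ g = 1 := by
  obtain ⟨b, hb, hb1⟩ := h.exists_eq_one
  have := hχ g b hb
  rwa [hg b hb, mul_inv_cancel_right, hb1, mul_one, eq_comm] at this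

/-- A nonzero homomorphism to `ℤ_p` that vanishes on `A` is injective modulo `A`. -/
theorem IsZpFactor.mem_of_eq_zero (hG : IsProP p G) (h : IsZpFactor A B ψ) {B' : Subgroup G}
    (hle : B' ≤ B) {c : G → ℤ_[p]} (hc : IsPadicHomOn B' c) (h0 : ∀ x ∈ B', x ∈ A → c x = 0)
    (hne : ∃ y ∈ B', c y ≠ 0) {x : G} (hx : x ∈ B') (hcx : c x = 0) : x ∈ A := by
  obtain ⟨y, hy, hcy⟩ := hne
  have := h.proportional hG hle hc h0 hx hy
  rw [hcx, mul_zero, eq_comm, mul_eq_zero, or_iff_left hcy] at this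
  exact (h.eq_zero_iff x (hle hx)).1 this

end Signs

/-! ### The virtually abelian case -/

section VirtuallyAbelian

variable {p : ℕ} [Fact p.Prime] {G : Type*} [Group G] [TopologicalSpace G]
  {U₁ U₂ U₃ : Subgroup G}

/-- If the open subgroup of the chain is abelian, the group acts on the factors by signs, and the
elements acting trivially form an abelian subgroup `M`. As no element acts by `-1` on all three
factors, `G / M` embeds into the Klein four-group `{±1}³ / {±1}`. -/
theorem IsZpChain.hasVirtuallyAbelianType (h : IsZpChain p U₁ U₂ U₃) (hG : IsProP p G)
    (htf : HasNoTorsion G) (hU : ∀ x ∈ U₃, ∀ y ∈ U₃, x * y = y * x) :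
    HasVirtuallyAbelianType p G := by
  classical
  have := hG.isTopologicalGroup
  have := hG.compactSpace
  have := hG.t2Space
  have hU₃n := h.normal₃
  obtain ⟨ψ₁, h₁⟩ := h.factor₁
  obtain ⟨ψ₂, h₂⟩ := h.factor₂
  obtain ⟨ψ₃, h₃⟩ := h.factor₃
  obtain ⟨χ₁, hχ₁c, hχ₁⟩ := h₁.exists_character hG inferInstance h.normal₁
  obtain ⟨χ₂, hχ₂c, hχ₂⟩ := h₂.exists_character hG h.normal₁ h.normal₂
  obtain ⟨χ₃, hχ₃c, hχ₃⟩ := h₃.exists_character hG h.normal₂ h.normal₃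
  have hn := hG.index_ne_zero_of_isOpen h.isOpen
  have hnU : ∀ g : G, g ^ U₃.index ∈ U₃ := U₃.pow_index_mem
  have hone₁ : ∀ u ∈ U₃, χ₁ u = 1 := fun u hu =>
    h₁.character_eq_one_of_commute hχ₁ fun b hb => hU u hu b (h₃.le (h₂.le hb))
  have hone₂ : ∀ u ∈ U₃, χ₂ u = 1 := fun u hu =>
    h₂.character_eq_one_of_commute hχ₂ fun b hb => hU u hu b (h₃.le hb)
  have hone₃ : ∀ u ∈ U₃, χ₃ u = 1 := fun u hu => h₃.character_eq_one hχ₃ hu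
  have hsq₁ : ∀ g, χ₁ g ^ 2 = 1 := fun g =>
    hG.character_sq_eq_one_of_pow hχ₁c hn (by rw [← map_pow, hone₁ _ (hnU g)])
  have hsq₂ : ∀ g, χ₂ g ^ 2 = 1 := fun g =>
    hG.character_sq_eq_one_of_pow hχ₂c hn (by rw [← map_pow, hone₂ _ (hnU g)])
  have hsq₃ : ∀ g, χ₃ g ^ 2 = 1 := fun g =>
    hG.character_sq_eq_one_of_pow hχ₃c hn (by rw [← map_pow, hone₃ _ (hnU g)])
  have hneg : ∀ g, χ₁ g = -1 → χ₂ g = -1 → χ₃ g = -1 → False := by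
    intro g g1 g2 g3
    have hcomm : g * g ^ U₃.index = g ^ U₃.index * g := (Commute.refl g).pow_right _
    have m3 := h₃.mem_of_character_eq_neg_one hχ₃ g3 (hnU g) hcomm
    have m2 := h₂.mem_of_character_eq_neg_one hχ₂ g2 m3 hcomm
    have m1 := h₁.mem_of_character_eq_neg_one hχ₁ g1 m2 hcomm
    rw [htf.eq_one_of_pow hn ((Subgroup.mem_bot).1 m1), map_one] at g1
    exact PadicInt.neg_one_ne_one g1.symm
  let M : Subgroup G := (χ₁.prod (χ₂.prod χ₃)).ker
  have hM : ∀ g, g ∈ M ↔ χ₁ g = 1 ∧ χ₂ g = 1 ∧ χ₃ g = 1 := fun g => by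
    simp [M, MonoidHom.mem_ker, Prod.ext_iff]
  have hMc : IsClosed (M : Set G) := by
    have : Continuous (χ₁.prod (χ₂.prod χ₃)) := hχ₁c.prodMk (hχ₂c.prodMk hχ₃c)
    exact isClosed_singleton.preimage this
  have hUM : U₃ ≤ M := fun u hu => (hM u).2 ⟨hone₁ u hu, hone₂ u hu, hone₃ u hu⟩
  have hMU₁ : ∀ g ∈ M, ∀ x ∈ U₁, g * x = x * g := fun g hg x hx =>
    h₁.commute_of_bot h.normal₁ hx (by rw [hχ₁ g x hx, ((hM g).1 hg).1, one_mul])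
  have hMU₂ : ∀ g ∈ M, ∀ x ∈ U₂, g * x = x * g := fun g hg x hx =>
    h₂.commute_of_pow htf h.normal₂ (hMU₁ g hg)
      (fun b hb => by rw [hχ₂ g b hb, ((hM g).1 hg).2.1, one_mul]) hn hx
      (hU _ (hnU g) x (h₃.le hx))
  have hMU₃ : ∀ g ∈ M, ∀ x ∈ U₃, g * x = x * g := fun g hg x hx =>
    h₃.commute_of_pow htf h.normal₃ (hMU₂ g hg)
      (fun b hb => by rw [hχ₃ g b hb, ((hM g).1 hg).2.2, one_mul]) hn hx (hU _ (hnU g) x hx)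
  have hMcomm : ∀ x ∈ M, ∀ y ∈ M, x * y = y * x :=
    htf.commute_of_relIndex_ne_zero (V := U₃)
      (ne_zero_of_dvd_ne_zero hn (Subgroup.relIndex_dvd_index_of_normal U₃ M))
      fun v hv k hk => (hMU₃ k hk v hv).symm
  have hMiso : Nonempty (M ≃ₜ* Multiplicative (ℤ_[p] × ℤ_[p] × ℤ_[p])) :=
    htf.nonempty_continuousMulEquiv_of_pow_mem hG hMc hMcomm hUM hn (fun g _ => hnU g)
      (h₃.nonempty_continuousMulEquiv_prod hG hU (h₂.nonempty_continuousMulEquiv_prod hG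
        (fun x hx y hy => hU x (h₃.le hx) y (h₃.le hy))
        (h₁.nonempty_continuousMulEquiv_of_bot hG)))
  have htopiso : M = ⊤ → HasVirtuallyAbelianType p G := by
    intro hMtop
    have : CompactSpace M := isCompact_iff_compactSpace.1 hMc.isCompact
    obtain ⟨i⟩ := nonempty_continuousMulEquiv_of_range_eq (f := MonoidHom.id G) (g := M.subtype)
      continuous_id continuous_subtype_val Function.injective_id Subtype.val_injective
      (by rw [Subgroup.range_subtype, hMtop, MonoidHom.range_eq_top.2 Function.surjective_id])
    exact Or.inl (hMiso.map i.trans)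
  by_cases hp : p = 2
  swap
  · refine htopiso (eq_top_iff.2 fun g _ => (hM g).2 ⟨?_, ?_, ?_⟩)
    · exact hG.character_eq_one_of_sq hp hχ₁c (hsq₁ g)
    · exact hG.character_eq_one_of_sq hp hχ₂c (hsq₂ g)
    · exact hG.character_eq_one_of_sq hp hχ₃c (hsq₃ g)
  subst hp
  -- the composite of `(χ₁, χ₂, χ₃)` with `{±1}³ → {±1}³ / {±1}`; it still has kernel `M`
  let θ : G →* ℤ_[2] × ℤ_[2] := (χ₁ * χ₂).prod (χ₂ * χ₃)
  have hθ : θ.ker = M := by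
    ext g
    have : g ∈ θ.ker ↔ χ₁ g * χ₂ g = 1 ∧ χ₂ g * χ₃ g = 1 := by
      simp [θ, MonoidHom.mem_ker, Prod.ext_iff]
    rw [this, hM]
    constructor
    · rintro ⟨e1, e2⟩
      have e3 : χ₁ g = χ₂ g := by linear_combination χ₂ g * e1 - χ₁ g * hsq₂ g
      have e4 : χ₃ g = χ₂ g := by linear_combination χ₂ g * e2 - χ₃ g * hsq₂ g
      rcases PadicInt.eq_one_or_neg_one_of_sq (hsq₂ g) with e5 | e5
      · exact ⟨e3.trans e5, e5, e4.trans e5⟩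
      · exact (hneg g (e3.trans e5) e5 (e4.trans e5)).elim
    · rintro ⟨e1, e2, e3⟩
      rw [e1, e2, e3, one_mul]
      exact ⟨rfl, rfl⟩
  let S : Finset (ℤ_[2] × ℤ_[2]) := {1, -1} ×ˢ {1, -1}
  have hSmem : ∀ g, θ g ∈ S := by
    intro g
    have e1 : (χ₁ g * χ₂ g) ^ 2 = 1 := by rw [mul_pow, hsq₁, hsq₂, one_mul]
    have e2 : (χ₂ g * χ₃ g) ^ 2 = 1 := by rw [mul_pow, hsq₂, hsq₃, one_mul]
    simp only [S, Finset.mem_product, Finset.mem_insert, Finset.mem_singleton]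
    exact ⟨PadicInt.eq_one_or_neg_one_of_sq e1, PadicInt.eq_one_or_neg_one_of_sq e2⟩
  have hMn : M.Normal := MonoidHom.normal_ker _
  have hQf : Finite (G ⧸ M) := by
    have : U₃.FiniteIndex := ⟨hn⟩
    have : M.FiniteIndex := Subgroup.finiteIndex_of_le hUM
    exact Subgroup.finite_quotient_of_finiteIndex
  have hcard : Nat.card (G ⧸ M) ≤ 4 := by
    let j : G ⧸ M → S := fun q => ⟨θ q.out, hSmem _⟩
    have hj : Function.Injective j := by
      intro x y hxy
      have e1 : θ x.out = θ y.out := congrArg Subtype.val hxy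
      have e2 : x.out⁻¹ * y.out ∈ θ.ker := by
        rw [MonoidHom.mem_ker, map_mul, ← e1, ← map_mul, inv_mul_cancel, map_one]
      rw [hθ] at e2
      rw [← QuotientGroup.out_eq' x, ← QuotientGroup.out_eq' y]
      exact QuotientGroup.eq.2 e2
    calc Nat.card (G ⧸ M) ≤ Nat.card S := Nat.card_le_card_of_injective j hj
      _ = S.card := by simp
      _ ≤ 2 * 2 := by
        rw [Finset.card_product]
        exact Nat.mul_le_mul Finset.card_le_two Finset.card_le_two
  have hexp : ∀ q : G ⧸ M, q ^ 2 = 1 := by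
    intro q
    obtain ⟨g, rfl⟩ := QuotientGroup.mk_surjective q
    rw [← QuotientGroup.mk_pow, QuotientGroup.eq_one_iff, hM, map_pow, map_pow, map_pow]
    exact ⟨hsq₁ g, hsq₂ g, hsq₃ g⟩
  obtain ⟨k, hk⟩ := IsPGroup.iff_card.1
    (show IsPGroup 2 (G ⧸ M) from fun q => ⟨1, by rw [pow_one, hexp]⟩)
  have hk2 : k < 3 := by
    by_contra hk3
    have : 2 ^ 3 ≤ 2 ^ k := Nat.pow_le_pow_right two_pos (not_lt.1 hk3)
    omega
  interval_cases k
  · exact htopiso (Subgroup.index_eq_one.1 (by rw [Subgroup.index_eq_card, hk, pow_zero]))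
  · refine Or.inr (Or.inr ⟨rfl, Or.inl ⟨M, hMn, hMiso, ?_⟩⟩)
    exact ⟨mulEquivOfPrimeCardEq (p := 2) (by rw [hk, pow_one]) (by simp)⟩
  · refine Or.inr (Or.inr ⟨rfl, Or.inr (Or.inr (Or.inr (Or.inl ⟨M, hMn, hMiso, ?_⟩)))⟩)
    have : Nontrivial (G ⧸ M) := Finite.one_lt_card_iff_nontrivial.1 (by rw [hk]; norm_num)
    have : IsKleinFour (G ⧸ M) :=
      ⟨by rw [hk]; norm_num, (Nat.prime_two.eq_one_or_self_of_dvd _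
        (Monoid.exponent_dvd_of_forall_pow_eq_one hexp)).resolve_left fun h1 => by
          obtain ⟨q, hq⟩ := exists_ne (1 : G ⧸ M)
          exact hq (by simpa [h1] using Monoid.pow_exponent_eq_one q)⟩
    exact IsKleinFour.nonempty_mulEquiv

end VirtuallyAbelian

/-! ### Infinite characters -/

section InfiniteCharacters

variable {p : ℕ} [Fact p.Prime] {G : Type*} [Group G] [TopologicalSpace G]
  {U₁ U₂ U₃ : Subgroup G}

/-- If the action on the bottom factor is infinite, the kernel of the resulting homomorphism `φ`
to `ℤ_p` is virtually an extension of `ℤ_p` by `U₁`. -/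
theorem IsZpChain.character₁_sq_eq_one (h : IsZpChain p U₁ U₂ U₃) (hG : IsProP p G)
    (htf : HasNoTorsion G) (hnot : ¬ HasZpSqSemidirectType p G) {ψ₁ : G → ℤ_[p]}
    (h₁ : IsZpFactor ⊥ U₁ ψ₁) {χ₁ : G →* ℤ_[p]} (hχ₁c : Continuous χ₁)
    (hχ₁ : ∀ g, ∀ b ∈ U₁, ψ₁ (g * b * g⁻¹) = χ₁ g * ψ₁ b) (g : G) : χ₁ g ^ 2 = 1 := by
  rcases hG.character_dichotomy hχ₁c with h1 | ⟨φ, hφ, ht, hφχ⟩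
  · exact h1 g
  exfalso
  apply hnot
  have := hG.isTopologicalGroup
  have := hG.compactSpace
  have htop : ∀ x : G, x ∈ (⊤ : Subgroup G) := Subgroup.mem_top
  have hU₃n := h.normal₃
  obtain ⟨ψ₂, h₂⟩ := h.factor₂
  obtain ⟨ψ₃, h₃⟩ := h.factor₃
  have hn := hG.index_ne_zero_of_isOpen h.isOpen
  have hφU₁ : ∀ x ∈ U₁, φ x = 0 := fun x hx => by
    rw [hφχ, h₁.character_eq_one hχ₁ hx, one_pow]
  let V : Subgroup G := hφ.ker ⊓ U₃
  have hVmem : ∀ x, x ∈ V ↔ φ x = 0 ∧ x ∈ U₃ := fun x => by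
    simp [V, IsPadicHomOn.mem_ker]
  have hkern : hφ.ker.Normal := ⟨fun x hx g => ⟨htop _, by
    rw [hφ.map_conj (htop g) (htop x)]; exact hx.2⟩⟩
  have hVn : V.Normal := inferInstance
  have hVc : IsClosed (V : Set G) := hφ.isClosed_ker.inter h₃.isClosed
  have hfac : ∃ ψ : G → ℤ_[p], IsZpFactor U₁ V ψ := by
    by_cases hφU₂ : ∀ y ∈ U₂, φ y = 0
    · obtain ⟨t, ht⟩ := ht
      have hVU : V = U₂ := by
        refine le_antisymm (fun x hx => ?_)
          fun x hx => (hVmem x).2 ⟨hφU₂ x hx, h₃.le hx⟩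
        refine h₃.mem_of_eq_zero hG le_rfl (hφ.mono le_top h₃.isClosed)
          (fun x _ hx => hφU₂ x hx) ⟨t ^ U₃.index, U₃.pow_index_mem t, ?_⟩ hx.2
          ((hVmem x).1 hx).1
        rw [hφ.map_pow (htop t), ht, mul_one]
        exact_mod_cast hn
      rw [hVU]
      exact h.factor₂
    · push Not at hφU₂
      obtain ⟨y, hy, hφy⟩ := hφU₂
      obtain ⟨b, hb, hb1⟩ := h₃.exists_eq_one
      obtain ⟨e, hec, he, rfl⟩ := hG.exists_padicPow b
      obtain ⟨e', hec', he', rfl⟩ := hG.exists_padicPow y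
      have m1 := padicPow_mem he hec h₃.isClosed hb (φ (e' 1))
      have m2 := padicPow_mem he' hec' h₂.isClosed hy (φ (e 1))
      refine h₃.restrict (A' := U₁) hVc inf_le_right (fun x hx => ⟨fun h1 => h₂.le h1,
        fun hxU₂ => h₂.mem_of_eq_zero hG le_rfl (hφ.mono le_top h₂.isClosed)
          (fun x _ hx => hφU₁ x hx) ⟨_, hy, hφy⟩ hxU₂ ((hVmem x).1 hx).1⟩)
        (fun x hx => (hVmem x).2 ⟨hφU₁ x hx, h₃.le (h₂.le hx)⟩) ?_
      -- the element `b ^ φ(y) * y ^ (-φ(b))` lies in the kernel of `φ` but not in `U₂`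
      refine ⟨e (φ (e' 1)) * (e' (φ (e 1)))⁻¹, (hVmem _).2
        ⟨?_, U₃.mul_mem m1 (U₃.inv_mem (h₃.le m2))⟩, fun hmem => ?_⟩
      · rw [hφ.map_mul _ (htop _) _ (htop _), hφ.map_inv (htop _),
          hφ.map_padicPow hec he (htop _) (φ (e' 1)),
          hφ.map_padicPow hec' he' (htop _) (φ (e 1))]
        ring
      · have m3 := h₃.map_of_mem ((U₂.mul_mem_cancel_right (U₂.inv_mem m2)).1 hmem)
        rw [h₃.toIsPadicHomOn.map_padicPow hec he hb, hb1, mul_one] at m3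
        exact hφy m3
  obtain ⟨ψ, hψ⟩ := hfac
  exact hasZpSqSemidirectType_of_kernel hφ hG htf ht h.normal₁ hVn h₁ hψ
    (fun v hv => ((hVmem v).1 hv).1) h.normal₃ h.isOpen (fun u hu h0 => (hVmem u).2 ⟨h0, hu⟩)
    hχ₁c hχ₁ fun k hk => (hφχ k).1 hk

/-- If the action on the middle factor is infinite, `U₂` is virtually the kernel of the resulting
homomorphism to `ℤ_p`. -/
theorem IsZpChain.character₂_sq_eq_one (h : IsZpChain p U₁ U₂ U₃) (hG : IsProP p G)
    (htf : HasNoTorsion G) (hnot : ¬ HasZpSqSemidirectType p G) {ψ₂ : G → ℤ_[p]}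
    (h₂ : IsZpFactor U₁ U₂ ψ₂) {χ₂ : G →* ℤ_[p]} (hχ₂c : Continuous χ₂)
    (hχ₂ : ∀ g, ∀ b ∈ U₂, ψ₂ (g * b * g⁻¹) = χ₂ g * ψ₂ b) (g : G) : χ₂ g ^ 2 = 1 := by
  rcases hG.character_dichotomy hχ₂c with h1 | ⟨φ, hφ, ht, hφχ⟩
  · exact h1 g
  exfalso
  have hU₃n := h.normal₃
  obtain ⟨ψ₁, h₁⟩ := h.factor₁
  obtain ⟨ψ₃, h₃⟩ := h.factor₃
  obtain ⟨χ₁, hχ₁c, hχ₁⟩ := h₁.exists_character hG inferInstance h.normal₁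
  have hφU₂ : ∀ x ∈ U₂, φ x = 0 := fun x hx => by
    rw [hφχ, h₂.character_eq_one hχ₂ hx, one_pow]
  refine hnot (hasZpSqSemidirectType_of_kernel hφ hG htf ht h.normal₁ h.normal₂ h₁ h₂ hφU₂
    h.normal₃ h.isOpen (fun u hu h0 => ?_) hχ₁c hχ₁
    fun k _ => h.character₁_sq_eq_one hG htf hnot h₁ hχ₁c hχ₁ k)
  obtain ⟨t, ht⟩ := ht
  refine h₃.mem_of_eq_zero hG le_rfl (hφ.mono le_top h₃.isClosed) (fun x _ hx => hφU₂ x hx)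
    ⟨t ^ U₃.index, U₃.pow_index_mem t, ?_⟩ hu h0
  rw [hφ.map_pow (Subgroup.mem_top t), ht, mul_one]
  exact_mod_cast hG.index_ne_zero_of_isOpen h.isOpen

end InfiniteCharacters

/-! ### Finite characters -/

section FiniteCharacters

variable {p : ℕ} [Fact p.Prime] {G : Type*} [Group G] [TopologicalSpace G]
  {U₁ U₂ U₃ : Subgroup G}

/-- The chain can be shrunk so that its first term is central in its last term. -/
theorem IsZpChain.exists_central (h : IsZpChain p U₁ U₂ U₃) (hG : IsProP p G)
    (htf : HasNoTorsion G) (hnot : ¬ HasZpSqSemidirectType p G) :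
    ∃ V₁ V₂ V₃ : Subgroup G, IsZpChain p V₁ V₂ V₃ ∧ ∀ x ∈ V₁, ∀ y ∈ V₃, x * y = y * x := by
  obtain ⟨ψ₁, h₁⟩ := h.factor₁
  obtain ⟨χ₁, hχ₁c, hχ₁⟩ := h₁.exists_character hG inferInstance h.normal₁
  have hsq := h.character₁_sq_eq_one hG htf hnot h₁ hχ₁c hχ₁
  refine ⟨_, _, _, h.inf_isOpen hG (MonoidHom.normal_ker χ₁)
    (isOpen_ker_of_sq_eq_one hχ₁c hsq), fun x hx y hy => ?_⟩
  refine (h₁.commute_of_bot h.normal₁ hx.1 ?_).symm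
  rw [hχ₁ y x hx.1, MonoidHom.mem_ker.1 hy.2, one_mul]

/-- If the characters `χ₁` and `χ₂` on the two lower factors are signs, then `G` acts on
`U₂ ≅ ℤ_p²` by the matrices with rows `(χ₁, β)` and `(0, χ₂)`, and `χ₁ β` is a homomorphism on the
subgroup of index at most two where `χ₁ = χ₂`. If it is nonzero, its kernel centralizes `U₂`, since
elements of the kernel acting by `-1` would be torsion. If it is zero, then `U₂` is virtually
central, and `G` is virtually abelian. -/
theorem IsZpChain.exists_commutative (h : IsZpChain p U₁ U₂ U₃) (hG : IsProP p G)
    (htf : HasNoTorsion G) (hnot : ¬ HasZpSqSemidirectType p G)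
    (hcen : ∀ x ∈ U₁, ∀ y ∈ U₃, x * y = y * x) :
    ∃ V₁ V₂ V₃ : Subgroup G, IsZpChain p V₁ V₂ V₃ ∧ ∀ x ∈ V₃, ∀ y ∈ V₃, x * y = y * x := by
  have := hG.isTopologicalGroup
  have := hG.compactSpace
  have hU₂n := h.normal₂
  have hU₃n := h.normal₃
  obtain ⟨ψ₁, h₁⟩ := h.factor₁
  obtain ⟨ψ₂, h₂⟩ := h.factor₂
  obtain ⟨ψ₃, h₃⟩ := h.factor₃
  obtain ⟨χ₁, hχ₁c, hχ₁⟩ := h₁.exists_character hG inferInstance h.normal₁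
  obtain ⟨χ₂, hχ₂c, hχ₂⟩ := h₂.exists_character hG h.normal₁ h.normal₂
  have hsq₁ := h.character₁_sq_eq_one hG htf hnot h₁ hχ₁c hχ₁
  have hsq₂ := h.character₂_sq_eq_one hG htf hnot h₂ hχ₂c hχ₂
  have hn := hG.index_ne_zero_of_isOpen h.isOpen
  have hU₂comm : ∀ x ∈ U₂, ∀ y ∈ U₂, x * y = y * x :=
    h₂.commute_of_central hG fun x hx y hy => hcen x hx y (h₃.le hy)
  obtain ⟨f, hf, hfψ⟩ := h₂.exists_extend hG hU₂comm h₁.toIsPadicHomOn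
  obtain ⟨b, hb, hb1⟩ := h₂.exists_eq_one
  let β : G → ℤ_[p] := fun g => f (g * b * g⁻¹) - χ₁ g * f b
  have hfc : Continuous fun g => f (g * b * g⁻¹) :=
    hf.continuousOn.comp_continuous (by fun_prop) fun g => hU₂n.conj_mem b hb g
  have hβc : Continuous β := hfc.sub (hχ₁c.mul continuous_const)
  have hfconj : ∀ g, ∀ v ∈ U₂, f (g * v * g⁻¹) = χ₁ g * f v + β g * ψ₂ v := by
    intro g v hv
    have hD : IsPadicHomOn U₂ fun v => f (g * v * g⁻¹) - χ₁ g * f v := by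
      refine ⟨h₂.isClosed, ?_, ?_⟩
      · exact (hf.continuousOn.comp (by fun_prop) fun x hx => hU₂n.conj_mem x hx g).sub
          (continuousOn_const.mul hf.continuousOn)
      · intro x hx y hy
        have : g * (x * y) * g⁻¹ = (g * x * g⁻¹) * (g * y * g⁻¹) := by group
        simp only [this]
        rw [hf.map_mul _ (hU₂n.conj_mem x hx g) _ (hU₂n.conj_mem y hy g), hf.map_mul _ hx _ hy]
        ring
    have := h₂.proportional hG le_rfl hD (fun x _ hx => by
      rw [hfψ x hx, hfψ _ (h.normal₁.conj_mem x hx g), hχ₁ g x hx, sub_self]) hv hb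
    rw [hb1] at this
    linear_combination this
  have hβmul : ∀ g g', β (g * g') = χ₁ g * β g' + χ₂ g' * β g := by
    intro g g'
    have e1 : g * g' * b * (g * g')⁻¹ = g * (g' * b * g'⁻¹) * g⁻¹ := by group
    simp only [β, e1]
    rw [hfconj g _ (hU₂n.conj_mem b hb g'), hχ₂ g' b hb, hb1, map_mul]
    simp only [β]
    ring
  have hcomm : ∀ g, χ₁ g = 1 → χ₂ g = 1 → β g = 0 → ∀ v ∈ U₂, g * v = v * g := by
    intro g g1 g2 g3 v hv
    have hgv := hU₂n.conj_mem v hv g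
    have hmem := U₂.mul_mem hgv (U₂.inv_mem hv)
    have m1 : g * v * g⁻¹ * v⁻¹ ∈ U₁ := by
      rw [← h₂.eq_zero_iff _ hmem, h₂.map_mul _ hgv _ (U₂.inv_mem hv),
        h₂.toIsPadicHomOn.map_inv hv, hχ₂ g v hv, g2]
      ring
    have m2 : g * v * g⁻¹ * v⁻¹ ∈ (⊥ : Subgroup G) := by
      rw [← h₁.eq_zero_iff _ m1, ← hfψ _ m1, hf.map_mul _ hgv _ (U₂.inv_mem hv),
        hf.map_inv hv, hfconj g v hv, g1, g3]
      ring
    rw [Subgroup.mem_bot, mul_inv_eq_one, mul_inv_eq_iff_eq_mul] at m2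
    exact m2
  let s : G →* ℤ_[p] := χ₁ * χ₂
  have hsc : Continuous s := hχ₁c.mul hχ₂c
  have hssq : ∀ g, s g ^ 2 = 1 := fun g => by
    rw [MonoidHom.mul_apply, mul_pow, hsq₁, hsq₂, one_mul]
  have hso := isOpen_ker_of_sq_eq_one hsc hssq
  have hscl : IsClosed (s.ker : Set G) := Subgroup.isClosed_of_isOpen _ hso
  have hsmem : ∀ g ∈ s.ker, χ₂ g = χ₁ g := by
    intro g hg
    have : χ₁ g * χ₂ g = 1 := hg
    linear_combination χ₁ g * this - χ₂ g * hsq₁ g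
  have hone₁ : ∀ u ∈ U₃, χ₁ u = 1 := fun u hu =>
    h₁.character_eq_one_of_commute hχ₁ fun x hx => (hcen x hx u hu).symm
  have hone₂ : ∀ v ∈ U₂, χ₂ v = 1 := fun v hv => h₂.character_eq_one hχ₂ hv
  have hU₂s : U₂ ≤ s.ker := fun v hv => by
    rw [MonoidHom.mem_ker, MonoidHom.mul_apply, hone₁ v (h₃.le hv), hone₂ v hv, one_mul]
  have hc : IsPadicHomOn s.ker fun g => χ₁ g * β g := by
    refine ⟨hscl, (hχ₁c.mul hβc).continuousOn, fun x hx y hy => ?_⟩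
    rw [hβmul, hsmem y hy, map_mul]
    linear_combination χ₁ y * β y * hsq₁ x + χ₁ x * β x * hsq₁ y
  have hcU₂ : ∀ v ∈ U₂, χ₁ v * β v = 0 := by
    intro v hv
    simp only [β]
    rw [hf.map_conj hv hb, hone₁ v (h₃.le hv)]
    ring
  by_cases hne : ∃ y ∈ s.ker, χ₁ y * β y ≠ 0
  · exfalso
    obtain ⟨c', k, hk, hkc, hc', hc1⟩ := hc.exists_rescale hne
    obtain ⟨y, hy, hcy⟩ := hne
    let A : Subgroup G := hc.ker
    have hfac : IsZpFactor A s.ker c' := by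
      refine ⟨hc', fun x hx => hx.1, fun x hx => ?_, hc1⟩
      have : x ∈ A ↔ χ₁ x * β x = 0 := ⟨fun hxA => hxA.2, fun h0 => ⟨hx, h0⟩⟩
      rw [this, hkc x hx, mul_eq_zero, or_iff_right hk]
    have hUA : ∀ u ∈ U₃, u ∈ A → u ∈ U₂ := by
      intro u hu huA
      refine h₃.mem_of_eq_zero hG (B' := U₃ ⊓ s.ker) inf_le_left
        (hc.mono inf_le_right (h₃.isClosed.inter hscl)) (fun x _ hx => hcU₂ x hx)
        ⟨y ^ U₃.index, ⟨U₃.pow_index_mem y, s.ker.pow_mem hy _⟩, ?_⟩ ⟨hu, huA.1⟩ huA.2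
      rw [hc.map_pow hy]
      exact mul_ne_zero (by exact_mod_cast hn) hcy
    have hpow : ∀ a ∈ A, a ^ U₃.index ∈ U₂ := fun a ha =>
      hUA _ (U₃.pow_index_mem a) (A.pow_mem ha _)
    have hAU₂ : ∀ a ∈ A, ∀ v ∈ U₂, a * v = v * a := by
      intro a ha
      have a1 : χ₁ a = 1 := by
        refine (PadicInt.eq_one_or_neg_one_of_sq (hsq₁ a)).resolve_right fun a1 => ?_
        have a2 : χ₂ a = -1 := (hsmem a ha.1).trans a1
        have haa : a * a ^ U₃.index = a ^ U₃.index * a := (Commute.refl a).pow_right _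
        have m1 := h₂.mem_of_character_eq_neg_one hχ₂ a2 (hpow a ha) haa
        have m2 := h₁.mem_of_character_eq_neg_one hχ₁ a1 m1 haa
        rw [htf.eq_one_of_pow hn (Subgroup.mem_bot.1 m2), map_one] at a1
        exact PadicInt.neg_one_ne_one a1.symm
      refine hcomm a a1 ((hsmem a ha.1).trans a1) ?_
      have : χ₁ a * β a = 0 := ha.2
      rwa [a1, one_mul] at this
    have hAcomm : ∀ x ∈ A, ∀ y ∈ A, x * y = y * x := by
      refine htf.commute_of_relIndex_ne_zero (V := A ⊓ U₃) ?_ fun v hv a ha => ?_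
      · rw [Subgroup.inf_relIndex_left]
        exact ne_zero_of_dvd_ne_zero hn (Subgroup.relIndex_dvd_index_of_normal U₃ A)
      · exact (hAU₂ a ha v (hUA v hv.2 hv.1)).symm
    have hAiso : Nonempty (A ≃ₜ* Multiplicative (ℤ_[p] × ℤ_[p])) :=
      htf.nonempty_continuousMulEquiv_of_pow_mem hG hc.isClosed_ker hAcomm
        (fun v hv => ⟨hU₂s hv, hcU₂ v hv⟩) hn hpow
        (h₂.nonempty_continuousMulEquiv_prod hG hU₂comm (h₁.nonempty_continuousMulEquiv_of_bot hG))
    exact hnot (hfac.hasZpSqSemidirectType hG hAiso (index_ker_of_sq_eq_one hssq))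
  · push Not at hne
    have hOn : (s.ker ⊓ χ₁.ker).Normal := inferInstance
    have hO : IsOpen ((s.ker ⊓ χ₁.ker : Subgroup G) : Set G) :=
      hso.inter (isOpen_ker_of_sq_eq_one hχ₁c hsq₁)
    have hV := h.inf_isOpen hG hOn hO
    refine ⟨_, _, _, hV, ?_⟩
    obtain ⟨ψ, hψ⟩ := hV.factor₃
    refine hψ.commute_of_central hG fun x hx y hy => ?_
    have y1 : χ₁ y = 1 := hy.2.2
    refine (hcomm y y1 ((hsmem y hy.2.1).trans y1) ?_ x hx.1).symm
    have := hne y hy.2.1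
    rwa [y1, one_mul] at this

end FiniteCharacters

theorem mainTheorem3 (p : ℕ) [Fact p.Prime] (G : Type*) [Group G] [TopologicalSpace G]
    (hG : IsProP p G) (htf : HasNoTorsion G) (hpoly : IsPolycyclicOfHirschLength p G 3) :
    (IsVirtuallyAbelian G ∧ HasVirtuallyAbelianType p G) ∨
    ((p ≠ 2 → IsZpSqSemidirectZp p G) ∧
      (p = 2 → ∃ H : Subgroup G,
        IsClosed (H : Set G) ∧ H.index = 2 ∧ IsZpSqSemidirectZp p H)) := by
  by_cases hnot : HasZpSqSemidirectType p G
  · exact Or.inr hnot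
  obtain ⟨_, _, _, hU⟩ := hpoly.exists_isZpChain hG
  obtain ⟨_, _, _, hV, hcen⟩ := hU.exists_central hG htf hnot
  obtain ⟨_, _, W, hW, hcomm⟩ := hV.exists_commutative hG htf hnot hcen
  exact Or.inl ⟨⟨W, hW.isOpen, hcomm⟩, hW.hasVirtuallyAbelianType hG htf hcomm⟩
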